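/- Let $d\in\{2,3\}$ and let $\Omega\subset\mathbb{R}^d$ be a bounded convex polygonal (polyhedral) domain. Let $\mathcal{T}_0,\mathcal{T}_1,\dots$ be conforming simplicial triangulations of $\Omega$, each $\mathcal{T}_{k}$ $(k\ge 1)$ being a refinement of $\mathcal{T}_{k-1}$, with mesh parameters $h_k=h_{k-1}/2>0$, and suppose that there is $\sigma>0$ independent of $k$ such that every simplex of $\mathcal{T}_k$ has diameter at most $\sigma h_k$ and every $d$-dimensional simplex of $\mathcal{T}_k$ contains a ball of radius $h_k/\sigma$. Let $V_k\subset H^1_0(\Omega)$ be the space of continuous functions that are affine on the simplices of $\mathcal{T}_k$ and vanish on $\partial\Omega$. For $\beta>0$ put $$\mathcal{B}((p,y),(q,z))=\beta^{1/2}(\nabla p,\nabla q)_{L_2(\Omega)}-(y,q)_{L_2(\Omega)}-(p,z)_{L_2(\Omega)}-\beta^{1/2}(\nabla y,\nabla z)_{L_2(\Omega)},$$ $$\|v\|_{H^1_\beta(\Omega)}^2=\|v\|_{L_2(\Omega)}^2+\beta^{1/2}|v|_{H^1(\Omega)}^2,\qquad (v,w)_k=h_k^d\sum_{x}v(x)w(x)\quad(v,w\in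 V_k),$$ where $x$ runs over the vertices of $\mathcal{T}_k$ in $\Omega$, and $[(p,y),(q,z)]_k=(p,q)_k+(y,z)_k$ on $V_k\times V_k$. The operator $\mathfrak{B}_k$ on $V_k\times V_k$ is defined by $[\mathfrak{B}_k u,w]_k=\mathcal{B}(u,w)$ for all $u,w\in V_k\times V_k$. Let $L_k:V_k\to V_k$ be linear, symmetric with respect to $(\cdot,\cdot)_k$, with $$c_1\|v\|_{H^1_\beta(\Omega)}^2\le (L_kv,v)_k\le c_2\|v\|_{H^1_\beta(\Omega)}^2\qquad\forall\,v\in V_k,$$ where $c_1,c_2>0$ are independent of $k$ and $\beta$, and let $\mathfrak{C}_k(p,y)=(L_kp,L_ky)$. Set $$|||u|||_{1,k}=[\mathfrak{B}_k\mathfrak{C}_k^{-1}\mathfrak{B}_ku,u]_k^{1/2},\qquad R_k=Id_k-\lambda_k\mathfrak{B}_k\mathfrak{C}_k^{-1}\mathfrak{B}_k,\qquad S_k=Id_k-\lambda_k\mathfrak{C}_k^{-1}\mathfrak{B}_k^2,$$ with damping factor $\lambda_k=2/(\lambda_{\min}(\mathfrak{B}_k\mathfrak{C}_k^{-1}\mathfrak{B}_k)+\lambda_{\max}(\mathfrak{B}_k\mathfrak{C}_k^{-1}\mathfrak{B}_k))$.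 For $k\ge1$ let $I_{k-1}^k:V_{k-1}\times V_{k-1}\to V_k\times V_k$ be the natural injection and let $P_k^{k-1}:V_k\times V_k\to V_{k-1}\times V_{k-1}$ be defined by $\mathcal{B}(P_k^{k-1}u,w)=\mathcal{B}(u,I_{k-1}^kw)$ for all $u\in V_k\times V_k$, $w\in V_{k-1}\times V_{k-1}$. Let $\|\cdot\|$ denote the operator norm on $V_k\times V_k$ with respect to $|||\cdot|||_{1,k}$. Then there exist constants $\gamma\in(0,1)$ and $C_\sharp>0$, independent of $k$ and $\beta$, such that for all $\beta>0$ and all $k\ge1$ with $\beta^{1/2}h_k^{-2}<1$, $$\|R_k\|\le\gamma\qquad\text{and}\qquad \|R_k^{m_2}(Id_k-I_{k-1}^kP_k^{k-1})S_k^{m_1}\|\le C_\sharp\,\gamma^{m_1+m_2}\quad\text{for all integers } m_1,m_2\ge0 .$$ -/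

import Mathlib

open MeasureTheory Set
open scoped Gradient NNReal ENNReal

noncomputable section

namespace KKTMultigrid

/-- A bounded convex polygonal (polyhedral) domain: the nonempty interior of the convex hull of
finitely many points. -/
def IsConvexPolytopalDomain {d : ℕ} (Ω : Set (EuclideanSpace ℝ (Fin d))) : Prop :=
  Ω.Nonempty ∧ ∃ F : Finset (EuclideanSpace ℝ (Fin d)),
    Ω = interior (convexHull ℝ (F : Set (EuclideanSpace ℝ (Fin d))))

/-- A (conforming) simplicial triangulation of `Ω`: a finite geometric simplicial complex whose
underlying space is the closure of `Ω`. -/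
structure Triangulation {d : ℕ} (Ω : Set (EuclideanSpace ℝ (Fin d))) extends
    Geometry.SimplicialComplex ℝ (EuclideanSpace ℝ (Fin d)) where
  finite_faces : faces.Finite
  space_eq : toSimplicialComplex.space = closure Ω

namespace Triangulation

variable {d : ℕ} {Ω : Set (EuclideanSpace ℝ (Fin d))}

/-- The `P₁` finite element space with zero boundary values: continuous functions which are affine
on every simplex of the triangulation and vanish on `∂Ω` (they are extended by zero
outside `Ω`). -/
def P1 (T : Triangulation Ω) : Submodule ℝ (EuclideanSpace ℝ (Fin d) → ℝ) where
  carrier := {v | Continuous v ∧ (∀ x, x ∉ Ω → v x = 0) ∧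
    ∀ s ∈ T.faces, ∃ a : EuclideanSpace ℝ (Fin d) →ᵃ[ℝ] ℝ,
      EqOn v a (convexHull ℝ (s : Set (EuclideanSpace ℝ (Fin d))))}
  add_mem' := by
    rintro v w ⟨hv, hv0, hva⟩ ⟨hw, hw0, hwa⟩
    refine ⟨hv.add hw, fun x hx => by simp [hv0 x hx, hw0 x hx], fun s hs => ?_⟩
    obtain ⟨a, ha⟩ := hva s hs
    obtain ⟨b, hb⟩ := hwa s hs
    exact ⟨a + b, fun x hx => by simp [ha hx, hb hx]⟩
  zero_mem' := ⟨continuous_const, fun _ _ => rfl, fun _ _ => ⟨0, fun _ _ => rfl⟩⟩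
  smul_mem' := by
    rintro c v ⟨hv, hv0, hva⟩
    refine ⟨hv.const_smul c, fun x hx => by simp [hv0 x hx], fun s hs => ?_⟩
    obtain ⟨a, ha⟩ := hva s hs
    exact ⟨c • a, fun x hx => by simp [ha hx]⟩

variable (T : Triangulation Ω)

theorem finite_vertices : T.vertices.Finite := by
  refine (T.finite_faces.biUnion (fun s _ => s.finite_toSet)).subset ?_
  intro x hx
  exact mem_biUnion (x := {x}) hx (by simp)

/-- The (finite) set of interior vertices. -/
def interiorVertices : Finset (EuclideanSpace ℝ (Fin d)) :=
  (T.finite_vertices.inter_of_left Ω).toFinset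

theorem mem_interiorVertices {x : EuclideanSpace ℝ (Fin d)} :
    x ∈ T.interiorVertices ↔ x ∈ T.vertices ∧ x ∈ Ω := by
  simp [interiorVertices]

theorem isCompact_closure (T : Triangulation Ω) : IsCompact (closure Ω) := by
  rw [← T.space_eq]
  exact T.finite_faces.isCompact_biUnion
    (fun s _ => s.finite_toSet.isCompact_convexHull ℝ)

/-- A finite element function is determined by its values at the interior vertices. -/
theorem eq_zero_of_vertices {v : EuclideanSpace ℝ (Fin d) → ℝ} (hv : v ∈ T.P1)
    (h : ∀ x ∈ T.interiorVertices, v x = 0) : v = 0 := by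
  obtain ⟨-, h0, ha⟩ := hv
  have hvert : ∀ x ∈ T.vertices, v x = 0 := fun x hx => by
    by_cases hxΩ : x ∈ Ω
    · exact h x (T.mem_interiorVertices.2 ⟨hx, hxΩ⟩)
    · exact h0 x hxΩ
  funext x
  by_cases hxΩ : x ∈ Ω
  · have hx : x ∈ T.space := T.space_eq ▸ subset_closure hxΩ
    obtain ⟨s, hs, hxs⟩ := Geometry.SimplicialComplex.mem_space_iff.1 hx
    obtain ⟨a, haE⟩ := ha s hs
    have hsub : convexHull ℝ (s : Set (EuclideanSpace ℝ (Fin d))) ⊆ a ⁻¹' {0} := by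
      refine convexHull_min (fun y hy => ?_) ((convex_singleton (0 : ℝ)).affine_preimage a)
      have hyv : y ∈ T.vertices :=
        T.down_closed hs (by simpa using hy) (Finset.singleton_nonempty y)
      show a y = 0
      rw [← haE (subset_convexHull ℝ _ hy)]
      exact hvert y hyv
    rw [haE hxs]
    exact hsub hxs
  · exact h0 x hxΩ

instance finiteDimensional_P1 : FiniteDimensional ℝ T.P1 := by
  let φ : T.P1 →ₗ[ℝ] (T.interiorVertices → ℝ) :=
    { toFun := fun v x => v.1 x
      map_add' := fun _ _ => rfl
      map_smul' := fun _ _ => rfl }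
  refine FiniteDimensional.of_injective φ ?_
  rw [← LinearMap.ker_eq_bot, LinearMap.ker_eq_bot']
  intro v hv
  exact Subtype.ext (T.eq_zero_of_vertices v.2 (fun x hx => congrFun hv ⟨x, hx⟩))

theorem integrable_mul {v w : EuclideanSpace ℝ (Fin d) → ℝ} (hv : v ∈ T.P1) (hw : w ∈ T.P1) :
    Integrable (fun x => v x * w x) := by
  refine (hv.1.mul hw.1).integrable_of_hasCompactSupport ?_
  refine HasCompactSupport.intro T.isCompact_closure (fun x hx => ?_)
  simp [hv.2.1 x (fun h => hx (subset_closure h))]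

/-- The union of the interiors of the simplices; it covers `Ω` up to a null set. -/
theorem ae_mem_interior :
    (Ω : Set (EuclideanSpace ℝ (Fin d))) ≤ᵐ[volume]
      (⋃ s ∈ T.faces, interior (convexHull ℝ (s : Set (EuclideanSpace ℝ (Fin d)))) :
        Set (EuclideanSpace ℝ (Fin d))) := by
  have hnull : volume (⋃ s ∈ T.faces,
      frontier (convexHull ℝ (s : Set (EuclideanSpace ℝ (Fin d))))) = 0 :=
    (measure_biUnion_null_iff T.finite_faces.countable).2
      (fun s _ => (convex_convexHull ℝ _).addHaar_frontier volume)
  rw [ae_le_set]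
  refine measure_mono_null ?_ hnull
  rintro x ⟨hxΩ, hxn⟩
  have hx : x ∈ T.space := T.space_eq ▸ subset_closure hxΩ
  obtain ⟨s, hs, hxs⟩ := Geometry.SimplicialComplex.mem_space_iff.1 hx
  refine mem_biUnion hs ⟨subset_closure hxs, fun hi => hxn (mem_biUnion hs hi)⟩

/-- On the interior of a simplex a finite element function is differentiable with constant
gradient. -/
theorem exists_hasGradientAt {v : EuclideanSpace ℝ (Fin d) → ℝ} (hv : v ∈ T.P1)
    {s : Finset (EuclideanSpace ℝ (Fin d))} (hs : s ∈ T.faces) :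
    ∃ g : EuclideanSpace ℝ (Fin d),
      ∀ x ∈ interior (convexHull ℝ (s : Set (EuclideanSpace ℝ (Fin d)))), HasGradientAt v g x := by
  obtain ⟨a, ha⟩ := hv.2.2 s hs
  let A : EuclideanSpace ℝ (Fin d) →ᴬ[ℝ] ℝ := ⟨a, a.continuous_of_finiteDimensional⟩
  refine ⟨(InnerProductSpace.toDual ℝ _).symm A.contLinear, fun x hx => ?_⟩
  rw [hasGradientAt_iff_hasFDerivAt, LinearIsometryEquiv.apply_symm_apply]
  have hA : HasFDerivAt A A.contLinear x := A.hasFDerivAt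
  refine hA.congr_of_eventuallyEq ?_
  filter_upwards [mem_interior_iff_mem_nhds.1 hx] with y hy
  exact ha hy

theorem ae_differentiableAt {v : EuclideanSpace ℝ (Fin d) → ℝ} (hv : v ∈ T.P1) :
    ∀ᵐ x ∂(volume.restrict Ω), DifferentiableAt ℝ v x := by
  refine Filter.Eventually.filter_mono
    (ae_mono (Measure.restrict_mono' T.ae_mem_interior le_rfl)) ?_
  have hm : MeasurableSet (⋃ s ∈ T.faces,
      interior (convexHull ℝ (s : Set (EuclideanSpace ℝ (Fin d))))) :=
    (isOpen_biUnion fun _ _ => isOpen_interior).measurableSet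
  filter_upwards [ae_restrict_mem hm] with x hx
  obtain ⟨s, hs, hxs⟩ := mem_iUnion₂.1 hx
  obtain ⟨g, hg⟩ := T.exists_hasGradientAt hv hs
  exact (hg x hxs).differentiableAt

theorem integrableOn_inner_gradient {v w : EuclideanSpace ℝ (Fin d) → ℝ} (hv : v ∈ T.P1)
    (hw : w ∈ T.P1) : IntegrableOn (fun x => inner ℝ (∇ v x) (∇ w x)) Ω := by
  refine IntegrableOn.mono_set_ae ?_ T.ae_mem_interior
  rw [integrableOn_finite_biUnion T.finite_faces]
  intro s hs
  obtain ⟨g, hg⟩ := T.exists_hasGradientAt hv hs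
  obtain ⟨g', hg'⟩ := T.exists_hasGradientAt hw hs
  have hfin : volume (interior (convexHull ℝ (s : Set (EuclideanSpace ℝ (Fin d))))) ≠ ∞ :=
    ((measure_mono interior_subset).trans_lt
      (s.finite_toSet.isCompact_convexHull ℝ).measure_lt_top).ne
  refine (integrableOn_const (C := (inner ℝ g g' : ℝ)) hfin).congr_fun (fun x hx => ?_)
    isOpen_interior.measurableSet
  simp only [(hg x hx).gradient, (hg' x hx).gradient]

/-- The `L₂(Ω)` inner product `(v, w)_{L₂(Ω)}` on the finite element space. -/
def mass : LinearMap.BilinForm ℝ T.P1 :=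
  LinearMap.mk₂ ℝ (fun v w => ∫ x in Ω, v.1 x * w.1 x)
    (fun u v w => by
      rw [← integral_add (T.integrable_mul u.2 w.2).integrableOn
        (T.integrable_mul v.2 w.2).integrableOn]
      exact integral_congr_ae (.of_forall fun x => add_mul _ _ _))
    (fun c v w => by
      rw [smul_eq_mul, ← integral_const_mul]
      exact integral_congr_ae (.of_forall fun x => mul_assoc _ _ _))
    (fun u v w => by
      rw [← integral_add (T.integrable_mul u.2 v.2).integrableOn
        (T.integrable_mul u.2 w.2).integrableOn]
      exact integral_congr_ae (.of_forall fun x => mul_add _ _ _))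
    (fun c v w => by
      rw [smul_eq_mul, ← integral_const_mul]
      exact integral_congr_ae (.of_forall fun x => mul_left_comm _ _ _))

theorem mass_apply (v w : T.P1) : T.mass v w = ∫ x in Ω, v.1 x * w.1 x := rfl

theorem gradient_add_ae (u v : T.P1) :
    ∀ᵐ x ∂(volume.restrict Ω), ∇ (u + v).1 x = ∇ u.1 x + ∇ v.1 x := by
  filter_upwards [T.ae_differentiableAt u.2, T.ae_differentiableAt v.2] with x hu hv
  simp only [gradient, Submodule.coe_add, fderiv_add hu hv, map_add]

theorem gradient_smul_ae (c : ℝ) (v : T.P1) :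
    ∀ᵐ x ∂(volume.restrict Ω), ∇ (c • v).1 x = c • ∇ v.1 x := by
  filter_upwards [T.ae_differentiableAt v.2] with x hv
  simp only [gradient, Submodule.coe_smul, fderiv_const_smul hv, map_smulₛₗ, conj_trivial]

/-- The Dirichlet form `(∇v, ∇w)_{L₂(Ω)}` on the finite element space. Finite element functions
are piecewise affine, so their weak gradient is their pointwise gradient, which exists almost
everywhere in `Ω`. -/
def stiffness : LinearMap.BilinForm ℝ T.P1 :=
  LinearMap.mk₂ ℝ (fun v w => ∫ x in Ω, inner ℝ (∇ v.1 x) (∇ w.1 x))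
    (fun u v w => by
      rw [← integral_add (T.integrableOn_inner_gradient u.2 w.2)
        (T.integrableOn_inner_gradient v.2 w.2)]
      refine integral_congr_ae ?_
      filter_upwards [T.gradient_add_ae u v] with x hx
      rw [hx, inner_add_left])
    (fun c v w => by
      rw [smul_eq_mul, ← integral_const_mul]
      refine integral_congr_ae ?_
      filter_upwards [T.gradient_smul_ae c v] with x hx
      rw [hx, real_inner_smul_left])
    (fun u v w => by
      rw [← integral_add (T.integrableOn_inner_gradient u.2 v.2)
        (T.integrableOn_inner_gradient u.2 w.2)]
      refine integral_congr_ae ?_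
      filter_upwards [T.gradient_add_ae v w] with x hx
      rw [hx, inner_add_right])
    (fun c v w => by
      rw [smul_eq_mul, ← integral_const_mul]
      refine integral_congr_ae ?_
      filter_upwards [T.gradient_smul_ae c w] with x hx
      rw [hx, real_inner_smul_right])

theorem stiffness_apply (v w : T.P1) :
    T.stiffness v w = ∫ x in Ω, inner ℝ (∇ v.1 x) (∇ w.1 x) := rfl

/-- The squared weighted norm `‖v‖²_{H¹_β(Ω)} = ‖v‖²_{L₂(Ω)} + β^{1/2} |v|²_{H¹(Ω)}`. -/
def normSqH1β (β : ℝ) (v : T.P1) : ℝ :=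
  T.mass v v + Real.sqrt β * T.stiffness v v

/-- The bilinear form
`𝓑((p,y),(q,z)) = β^{1/2}(∇p,∇q) - (y,q) - (p,z) - β^{1/2}(∇y,∇z)` (all inner products in
`L₂(Ω)`), on pairs of finite element functions. -/
def saddle (β : ℝ) : LinearMap.BilinForm ℝ (T.P1 × T.P1) :=
  Real.sqrt β • T.stiffness.compl₁₂ (LinearMap.fst ℝ T.P1 T.P1) (LinearMap.fst ℝ T.P1 T.P1)
    - T.mass.compl₁₂ (LinearMap.snd ℝ T.P1 T.P1) (LinearMap.fst ℝ T.P1 T.P1)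
    - T.mass.compl₁₂ (LinearMap.fst ℝ T.P1 T.P1) (LinearMap.snd ℝ T.P1 T.P1)
    - Real.sqrt β • T.stiffness.compl₁₂ (LinearMap.snd ℝ T.P1 T.P1) (LinearMap.snd ℝ T.P1 T.P1)

theorem saddle_apply (β : ℝ) (u w : T.P1 × T.P1) :
    T.saddle β u w = Real.sqrt β * T.stiffness u.1 w.1 - T.mass u.2 w.1 - T.mass u.1 w.2
      - Real.sqrt β * T.stiffness u.2 w.2 := rfl

/-- The mesh-dependent inner product `(v,w) = h^d ∑ v(x) w(x)`, the sum being over the interior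
vertices. -/
def nodal (h : ℝ) : LinearMap.BilinForm ℝ T.P1 :=
  LinearMap.mk₂ ℝ (fun v w => h ^ d * ∑ x ∈ T.interiorVertices, v.1 x * w.1 x)
    (fun u v w => by
      rw [← mul_add, ← Finset.sum_add_distrib]
      exact congrArg _ (Finset.sum_congr rfl fun x _ => add_mul _ _ _))
    (fun c v w => by
      have e : ∑ x ∈ T.interiorVertices, (c • v).1 x * w.1 x
          = c * ∑ x ∈ T.interiorVertices, v.1 x * w.1 x := by
        rw [Finset.mul_sum]
        exact Finset.sum_congr rfl fun x _ => mul_assoc c (v.1 x) (w.1 x)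
      rw [e, smul_eq_mul, mul_left_comm])
    (fun u v w => by
      rw [← mul_add, ← Finset.sum_add_distrib]
      exact congrArg _ (Finset.sum_congr rfl fun x _ => mul_add _ _ _))
    (fun c v w => by
      have e : ∑ x ∈ T.interiorVertices, v.1 x * (c • w).1 x
          = c * ∑ x ∈ T.interiorVertices, v.1 x * w.1 x := by
        rw [Finset.mul_sum]
        exact Finset.sum_congr rfl fun x _ => mul_left_comm (v.1 x) c (w.1 x)
      rw [e, smul_eq_mul, mul_left_comm])

theorem nodal_apply (h : ℝ) (v w : T.P1) :
    T.nodal h v w = h ^ d * ∑ x ∈ T.interiorVertices, v.1 x * w.1 x := rfl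

/-- The mesh-dependent inner product `[(p,y),(q,z)] = (p,q) + (y,z)` on pairs. -/
def nodalPair (h : ℝ) : LinearMap.BilinForm ℝ (T.P1 × T.P1) :=
  (T.nodal h).compl₁₂ (LinearMap.fst ℝ T.P1 T.P1) (LinearMap.fst ℝ T.P1 T.P1)
    + (T.nodal h).compl₁₂ (LinearMap.snd ℝ T.P1 T.P1) (LinearMap.snd ℝ T.P1 T.P1)

theorem nodalPair_apply (h : ℝ) (u w : T.P1 × T.P1) :
    T.nodalPair h u w = T.nodal h u.1 w.1 + T.nodal h u.2 w.2 := rfl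

theorem mass_symm (v w : T.P1) : T.mass v w = T.mass w v := by
  simp only [mass_apply, mul_comm]

theorem stiffness_symm (v w : T.P1) : T.stiffness v w = T.stiffness w v := by
  simp only [stiffness_apply, real_inner_comm]

theorem mass_self_nonneg (v : T.P1) : 0 ≤ T.mass v v :=
  integral_nonneg fun x => mul_self_nonneg (v.1 x)

theorem stiffness_self_nonneg (v : T.P1) : 0 ≤ T.stiffness v v :=
  integral_nonneg fun x => real_inner_self_nonneg (x := ∇ v.1 x)

theorem eq_zero_of_mass_self {v : T.P1} (h : T.mass v v = 0) : v = 0 := by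
  have h' : ∫ x, v.1 x * v.1 x = 0 := by
    rw [← setIntegral_eq_integral_of_forall_compl_eq_zero (s := Ω)
      (fun x hx => by simp [v.2.2.1 x hx])]
    exact h
  rw [integral_eq_zero_iff_of_nonneg (fun x => mul_self_nonneg _) (T.integrable_mul v.2 v.2)] at h'
  have h2 := (Continuous.ae_eq_iff_eq volume (v.2.1.mul v.2.1) continuous_const).1 h'
  refine Subtype.ext (funext fun x => ?_)
  exact mul_self_eq_zero.1 (congrFun h2 x)

theorem saddle_nondegenerate (β : ℝ) : (T.saddle β).Nondegenerate := by
  refine LinearMap.BilinForm.Nondegenerate.ofSeparatingLeft ?_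
  rintro ⟨p, y⟩ h
  have h1 := h (p - y, -y - p)
  simp only [saddle_apply, map_sub, map_neg] at h1
  have e1 := T.mass_symm y p
  have e2 := T.stiffness_symm y p
  have hβ := Real.sqrt_nonneg β
  have h2 : T.mass p p + T.mass y y
      + Real.sqrt β * (T.stiffness p p + T.stiffness y y) = 0 := by
    rw [e1, e2] at h1
    linarith
  have a1 := T.mass_self_nonneg p
  have a2 := T.mass_self_nonneg y
  have a3 := mul_nonneg hβ (add_nonneg (T.stiffness_self_nonneg p) (T.stiffness_self_nonneg y))
  rw [T.eq_zero_of_mass_self (v := p) (by linarith),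
    T.eq_zero_of_mass_self (v := y) (by linarith)]
  rfl

theorem nodal_self_nonneg {h : ℝ} (hh : 0 < h) (v : T.P1) : 0 ≤ T.nodal h v v :=
  mul_nonneg (by positivity) (Finset.sum_nonneg fun _ _ => mul_self_nonneg _)

theorem eq_zero_of_nodal_self {h : ℝ} (hh : 0 < h) {v : T.P1} (hv : T.nodal h v v = 0) :
    v = 0 := by
  rw [nodal_apply, mul_eq_zero, or_iff_right (pow_pos hh d).ne',
    Finset.sum_eq_zero_iff_of_nonneg (fun _ _ => mul_self_nonneg _)] at hv
  exact Subtype.ext (T.eq_zero_of_vertices v.2 fun x hx => mul_self_eq_zero.1 (hv x hx))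

theorem nodalPair_nondegenerate {h : ℝ} (hh : 0 < h) : (T.nodalPair h).Nondegenerate := by
  refine LinearMap.BilinForm.Nondegenerate.ofSeparatingLeft ?_
  rintro ⟨p, y⟩ hu
  have h1 := hu (p, y)
  rw [nodalPair_apply] at h1
  have a1 := T.nodal_self_nonneg hh p
  have a2 := T.nodal_self_nonneg hh y
  dsimp only at h1
  rw [T.eq_zero_of_nodal_self hh (v := p) (by linarith),
    T.eq_zero_of_nodal_self hh (v := y) (by linarith)]
  rfl

end Triangulation

/-- A hierarchy of triangulations `T₀, T₁, …` of `Ω`, each one a refinement of its predecessor, with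
mesh parameters satisfying `h_{k+1} = h_k / 2`. Uniform shape regularity and comparability of the
element sizes with the mesh parameter are expressed by one number `σ`, independent of the
level: every simplex of `T_k` has diameter at most `σ h_k`, and every `d`-dimensional simplex
of `T_k` contains a ball of radius `h_k / σ`. -/
structure MeshHierarchy {d : ℕ} (Ω : Set (EuclideanSpace ℝ (Fin d))) where
  T : ℕ → Triangulation Ω
  h : ℕ → ℝ
  σ : ℝ
  h_pos : ∀ k, 0 < h k
  h_succ : ∀ k, h (k + 1) = h k / 2
  refines : ∀ k, ∀ s ∈ (T (k + 1)).faces, ∃ t ∈ (T k).faces,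
    convexHull ℝ (s : Set (EuclideanSpace ℝ (Fin d))) ⊆ convexHull ℝ t
  σ_pos : 0 < σ
  diam_le : ∀ k, ∀ s ∈ (T k).faces,
    Metric.diam (convexHull ℝ (s : Set (EuclideanSpace ℝ (Fin d)))) ≤ σ * h k
  ball_subset : ∀ k, ∀ s ∈ (T k).faces, s.card = d + 1 →
    ∃ c, Metric.closedBall c (h k / σ) ⊆ convexHull ℝ (s : Set (EuclideanSpace ℝ (Fin d)))

namespace MeshHierarchy

variable {d : ℕ} {Ω : Set (EuclideanSpace ℝ (Fin d))} (M : MeshHierarchy Ω)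

/-- The finite element space `V_k`. -/
abbrev V (k : ℕ) : Submodule ℝ (EuclideanSpace ℝ (Fin d) → ℝ) := (M.T k).P1

theorem V_mono : Monotone M.V := by
  refine monotone_nat_of_le_succ fun k v hv => ⟨hv.1, hv.2.1, fun s hs => ?_⟩
  obtain ⟨t, ht, hst⟩ := M.refines k s hs
  obtain ⟨a, ha⟩ := hv.2.2 t ht
  exact ⟨a, ha.mono hst⟩

/-- The product space `V_k × V_k`. -/
abbrev W (k : ℕ) : Type := M.V k × M.V k

/-- The mesh-dependent inner product `[·,·]_k` on `V_k × V_k`. -/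
abbrev ip (k : ℕ) : LinearMap.BilinForm ℝ (M.W k) := (M.T k).nodalPair (M.h k)

/-- The coarse-to-fine operator `V_j × V_j → V_k × V_k`, `j ≤ k`: the natural injection. -/
def prolong {j k : ℕ} (hjk : j ≤ k) : M.W j →ₗ[ℝ] M.W k :=
  (Submodule.inclusion (M.V_mono hjk)).prodMap (Submodule.inclusion (M.V_mono hjk))

/-- The operator `𝔅_k` on `V_k × V_k` that represents `𝓑` with respect to `[·,·]_k`. -/
def opB (β : ℝ) (k : ℕ) : Module.End ℝ (M.W k) :=
  ((M.ip k).toDual ((M.T k).nodalPair_nondegenerate (M.h_pos k))).symm.toLinearMap ∘ₗ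
    (M.T k).saddle β

/-- The defining property of `𝔅_k`. -/
theorem ip_opB (β : ℝ) (k : ℕ) (u w : M.W k) :
    M.ip k (M.opB β k u) w = (M.T k).saddle β u w :=
  LinearMap.BilinForm.apply_toDual_symm_apply
    (hB := (M.T k).nodalPair_nondegenerate (M.h_pos k)) _ _

/-- The Ritz projection `V_k × V_k → V_j × V_j`, `j ≤ k`: the transpose of the natural injection
with respect to `𝓑`. -/
def ritz (β : ℝ) {j k : ℕ} (hjk : j ≤ k) : M.W k →ₗ[ℝ] M.W j :=
  (((M.T j).saddle β).toDual ((M.T j).saddle_nondegenerate β)).symm.toLinearMap ∘ₗ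
    (((M.T k).saddle β).compl₂ (M.prolong hjk))

/-- The defining property of the Ritz projection. -/
theorem saddle_ritz (β : ℝ) {j k : ℕ} (hjk : j ≤ k) (u : M.W k) (w : M.W j) :
    (M.T j).saddle β (M.ritz β hjk u) w = (M.T k).saddle β u (M.prolong hjk w) :=
  LinearMap.BilinForm.apply_toDual_symm_apply
    (hB := (M.T j).saddle_nondegenerate β) _ _

/-- Admissibility of the operator `L` on `V_k`: it is symmetric with respect to `(·,·)_k`, and
`(L v, v)_k` is equivalent to `‖v‖²_{H¹_β(Ω)}` with constants `c₁`, `c₂`. -/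
def IsAdmissible (β c₁ c₂ : ℝ) (k : ℕ) (L : Module.End ℝ (M.V k)) : Prop :=
  (∀ v w, (M.T k).nodal (M.h k) (L v) w = (M.T k).nodal (M.h k) v (L w)) ∧
  ∀ v, c₁ * (M.T k).normSqH1β β v ≤ (M.T k).nodal (M.h k) (L v) v ∧
    (M.T k).nodal (M.h k) (L v) v ≤ c₂ * (M.T k).normSqH1β β v

variable {M}

/-- The block-diagonal operator `ℭ_k (p, y) = (L p, L y)`. -/
def opC {k : ℕ} (L : Module.End ℝ (M.V k)) : Module.End ℝ (M.W k) := L.prodMap L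

/-- If `L` is admissible then `ℭ_k` is invertible, so that `Ring.inverse` is its inverse. -/
theorem isUnit_opC {β c₁ c₂ : ℝ} {k : ℕ} {L : Module.End ℝ (M.V k)} (hc₁ : 0 < c₁)
    (hL : M.IsAdmissible β c₁ c₂ k L) : IsUnit (opC L) := by
  rw [LinearMap.isUnit_iff_ker_eq_bot, LinearMap.ker_eq_bot']
  have key : ∀ v, L v = 0 → v = 0 := fun v hv => by
    have h1 := (hL.2 v).1
    rw [hv, map_zero, LinearMap.zero_apply] at h1
    have a1 := (M.T k).mass_self_nonneg v
    have a2 := mul_nonneg (Real.sqrt_nonneg β) ((M.T k).stiffness_self_nonneg v)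
    have h2 : (M.T k).normSqH1β β v ≤ 0 := nonpos_of_mul_nonpos_right h1 hc₁
    unfold Triangulation.normSqH1β at h2
    exact (M.T k).eq_zero_of_mass_self (by linarith)
  rintro ⟨p, y⟩ hu
  obtain ⟨h1, h2⟩ := Prod.mk.inj hu
  exact Prod.ext (key p h1) (key y h2)

/-- The operator `𝔅_k ℭ_k⁻¹ 𝔅_k`. -/
def opA (β : ℝ) {k : ℕ} (L : Module.End ℝ (M.V k)) : Module.End ℝ (M.W k) :=
  M.opB β k * Ring.inverse (opC L) * M.opB β k

/-- The mesh-dependent norm `|||u|||_{1,k} = [𝔅_k ℭ_k⁻¹ 𝔅_k u, u]_k^{1/2}`. -/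
def norm1 (β : ℝ) {k : ℕ} (L : Module.End ℝ (M.V k)) (u : M.W k) : ℝ :=
  Real.sqrt (M.ip k (opA β L u) u)

/-- The damping factor `λ_k = 2 / (λ_min + λ_max)` for the levels with `β^{1/2} h_k⁻² < 1`, where
`λ_min` and `λ_max` are the extreme eigenvalues of `𝔅_k ℭ_k⁻¹ 𝔅_k`. -/
def damping (β : ℝ) {k : ℕ} (L : Module.End ℝ (M.V k)) : ℝ :=
  2 / (sInf {μ : ℝ | (opA β L).HasEigenvalue μ} + sSup {μ : ℝ | (opA β L).HasEigenvalue μ})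

/-- The error propagation operator `R_k = Id - λ_k 𝔅_k ℭ_k⁻¹ 𝔅_k` of one post-smoothing step. -/
def postSmooth (β : ℝ) {k : ℕ} (L : Module.End ℝ (M.V k)) : Module.End ℝ (M.W k) :=
  1 - damping β L • opA β L

/-- The error propagation operator `S_k = Id - λ_k ℭ_k⁻¹ 𝔅_k²` of one pre-smoothing step. -/
def preSmooth (β : ℝ) {k : ℕ} (L : Module.End ℝ (M.V k)) : Module.End ℝ (M.W k) :=
  1 - damping β L • (Ring.inverse (opC L) * M.opB β k ^ 2)

/-- The error propagation operator `R_k^{m₂} (Id - I P) S_k^{m₁}` of the two-grid algorithm for the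
levels `k` and `k - 1`, with `m₁` pre-smoothing and `m₂` post-smoothing steps; `I` is the natural
injection and `P` the Ritz projection. -/
def twoGrid (β : ℝ) {k : ℕ} (L : Module.End ℝ (M.V k)) (m₁ m₂ : ℕ) : Module.End ℝ (M.W k) :=
  postSmooth β L ^ m₂ *
    (1 - M.prolong (Nat.sub_le k 1) ∘ₗ M.ritz β (Nat.sub_le k 1)) *
    preSmooth β L ^ m₁

/-- The operator norm with respect to `|||·|||_{1,k}`: the infimum of all `r ≥ 0` with
`|||Q u||| ≤ r |||u|||` for all `u` (with value `∞` if there were no such `r`). -/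
def opNorm1 (β : ℝ) {k : ℕ} (L : Module.End ℝ (M.V k)) (Q : Module.End ℝ (M.W k)) : ℝ≥0∞ :=
  ⨅ (r : ℝ≥0) (_ : ∀ u, norm1 β L (Q u) ≤ r * norm1 β L u), (r : ℝ≥0∞)

end MeshHierarchy

end KKTMultigrid

end

/-! When `β^{1/2} h_k⁻² < 1`, the problem is uniformly well conditioned with respect to `[·,·]_k`.
The inverse estimate bounds `β^{1/2}|v|²_{H¹}` by a multiple of `β^{1/2} h_k⁻² (v,v)_k`, so the
weighted norm is equivalent to the nodal norm with constants `a`, `b` depending only on `σ` and `d`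
(`exists_normSqH1β_equiv`).

The form `𝓑` is bounded in the weighted norm with constant one (`saddle_sq_le`). Testing `(p, y)`
with `(p - y, -y - p)`, whose norm is `√2` times as large, reproduces the squared norm exactly
(`saddle_twist`). Hence `𝔅_k` and its inverse are bounded in the nodal norm. With the two-sided
bounds on `ℭ_k`, the spectrum of `𝔅_k ℭ_k⁻¹ 𝔅_k` lies in a fixed interval `[α, Λ]`
(`ip_opA_self_bounds`), and optimally damped Richardson iteration contracts the energy norm by `(Λ -
α)/(Λ + α)` (`richardson_contraction`). This number is `γ`.

The coarse correction only has to be bounded, not small. The same inf-sup test makes the Ritz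
projection stable in the weighted norm (`pairNormSq_ritz_le`), hence in the nodal norm.
Pre-smoothing reduces to post-smoothing through `𝔅_k S_k = R_k 𝔅_k` (`opB_preSmooth_pow`). Passing
between the equivalent norms costs a fixed constant, which is absorbed in `C_♯`; all decay comes
from the powers of `γ`. -/

namespace KKTMultigrid

/-! ### Vertex values versus `L₂` and `H¹` norms on one triangulation. -/

namespace Triangulation

variable {d : ℕ} {Ω : Set (EuclideanSpace ℝ (Fin d))} (T : Triangulation Ω)

/-- On a simplex, a finite element function is dominated by its absolute value at some vertex. -/
theorem exists_vertex_abs_le {v : EuclideanSpace ℝ (Fin d) → ℝ} (hv : v ∈ T.P1)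
    {s : Finset (EuclideanSpace ℝ (Fin d))} (hs : s ∈ T.faces) {y : EuclideanSpace ℝ (Fin d)}
    (hy : y ∈ convexHull ℝ (s : Set (EuclideanSpace ℝ (Fin d)))) :
    ∃ x ∈ s, |v y| ≤ |v x| := by
  obtain ⟨a, ha⟩ := hv.2.2 s hs
  have hconv : ConvexOn ℝ (a ⁻¹' univ) ((norm : ℝ → ℝ) ∘ a) :=
    (convexOn_norm convex_univ).comp_affineMap a
  obtain ⟨x, hx, hle⟩ := hconv.exists_ge_of_mem_convexHull (subset_univ _) hy
  refine ⟨x, hx, ?_⟩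
  rw [ha hy, ha (subset_convexHull ℝ _ hx)]
  exact hle

theorem mem_vertices_of_mem {s : Finset (EuclideanSpace ℝ (Fin d))} (hs : s ∈ T.faces)
    {x : EuclideanSpace ℝ (Fin d)} (hx : x ∈ s) : x ∈ T.vertices :=
  T.down_closed hs (by simpa using hx) (Finset.singleton_nonempty x)

/-- The sum of the squares of the values of `v` at the interior vertices within distance `D`
of `y`. -/
noncomputable def localSum (D : ℝ) (v : EuclideanSpace ℝ (Fin d) → ℝ)
    (y : EuclideanSpace ℝ (Fin d)) : ℝ :=
  ∑ x ∈ T.interiorVertices, (Metric.closedBall x D).indicator (fun _ => v x ^ 2) y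

theorem localSum_nonneg (D : ℝ) (v : EuclideanSpace ℝ (Fin d) → ℝ)
    (y : EuclideanSpace ℝ (Fin d)) : 0 ≤ T.localSum D v y :=
  Finset.sum_nonneg fun _ _ => indicator_nonneg (fun _ _ => sq_nonneg _) _

theorem sq_le_localSum {D : ℝ}
    (hD : ∀ s ∈ T.faces, Metric.diam (convexHull ℝ (s : Set (EuclideanSpace ℝ (Fin d)))) ≤ D)
    {v : EuclideanSpace ℝ (Fin d) → ℝ} (hv : v ∈ T.P1)
    {s : Finset (EuclideanSpace ℝ (Fin d))} (hs : s ∈ T.faces) {y z : EuclideanSpace ℝ (Fin d)}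
    (hy : y ∈ convexHull ℝ (s : Set (EuclideanSpace ℝ (Fin d))))
    (hz : z ∈ convexHull ℝ (s : Set (EuclideanSpace ℝ (Fin d)))) :
    v z ^ 2 ≤ T.localSum D v y := by
  obtain ⟨x, hx, hle⟩ := T.exists_vertex_abs_le hv hs hz
  refine (sq_le_sq.2 hle).trans ?_
  by_cases hxΩ : x ∈ Ω
  · have hmem : y ∈ Metric.closedBall x D :=
      (Metric.dist_le_diam_of_mem (s.finite_toSet.isCompact_convexHull ℝ).isBounded hy
        (subset_convexHull ℝ _ hx)).trans (hD s hs)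
    have h1 := Finset.single_le_sum
      (f := fun x => (Metric.closedBall x D).indicator (fun _ => v x ^ 2) y)
      (fun x _ => indicator_nonneg (fun _ _ => sq_nonneg (v x)) y)
      (T.mem_interiorVertices.2 ⟨T.mem_vertices_of_mem hs hx, hxΩ⟩)
    rw [indicator_of_mem hmem] at h1
    exact h1
  -- A dominating vertex outside `Ω` has value zero, so summing over interior vertices loses
  -- nothing.
  · rw [hv.2.1 x hxΩ]
    simpa using T.localSum_nonneg D v y

theorem integrable_localSum (D : ℝ) (v : EuclideanSpace ℝ (Fin d) → ℝ) :
    Integrable (T.localSum D v) := by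
  refine integrable_finsetSum _ fun x _ => ?_
  rw [integrable_indicator_iff measurableSet_closedBall]
  exact integrableOn_const (isCompact_closedBall x D).measure_lt_top.ne

/-- Each vertex contributes its squared value times the volume of a ball of radius `D`. Bounding by
balls avoids counting the simplices that meet at a vertex. -/
theorem integral_localSum_le {D : ℝ} (hD : 0 ≤ D) (v : EuclideanSpace ℝ (Fin d) → ℝ) :
    ∫ y in Ω, T.localSum D v y ≤
      D ^ d * volume.real (Metric.ball (0 : EuclideanSpace ℝ (Fin d)) 1) *
        ∑ x ∈ T.interiorVertices, v x ^ 2 := by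
  refine (setIntegral_le_integral (T.integrable_localSum D v)
    (.of_forall (T.localSum_nonneg D v))).trans (le_of_eq ?_)
  unfold localSum
  rw [integral_finsetSum, Finset.mul_sum]
  · refine Finset.sum_congr rfl fun x _ => ?_
    rw [integral_indicator_const _ measurableSet_closedBall,
      Measure.addHaar_real_closedBall _ _ hD, finrank_euclideanSpace_fin, smul_eq_mul]
  · intro x _
    rw [integrable_indicator_iff measurableSet_closedBall]
    exact integrableOn_const (isCompact_closedBall x D).measure_lt_top.ne

theorem mass_self_le {D : ℝ} (hD0 : 0 ≤ D)
    (hD : ∀ s ∈ T.faces, Metric.diam (convexHull ℝ (s : Set (EuclideanSpace ℝ (Fin d)))) ≤ D)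
    (v : T.P1) :
    T.mass v v ≤ D ^ d * volume.real (Metric.ball (0 : EuclideanSpace ℝ (Fin d)) 1) *
        ∑ x ∈ T.interiorVertices, v.1 x ^ 2 := by
  refine le_trans ?_ (T.integral_localSum_le hD0 v.1)
  refine setIntegral_mono_ae_restrict (T.integrable_mul v.2 v.2).integrableOn
    (T.integrable_localSum D v.1).integrableOn ?_
  refine .of_forall fun y => ?_
  by_cases hy : y ∈ Ω
  · have hy' : y ∈ T.space := T.space_eq ▸ subset_closure hy
    obtain ⟨s, hs, hys⟩ := Geometry.SimplicialComplex.mem_space_iff.1 hy'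
    simpa only [← sq] using T.sq_le_localSum hD v.2 hs hys hys
  · simpa [v.2.2.1 y hy] using T.localSum_nonneg D v.1 y

/-- A hull with interior points spans the whole space, and its vertices are affinely independent.
This makes the inscribed-ball condition available for simplices that matter almost everywhere. -/
theorem card_eq_of_interior_nonempty {s : Finset (EuclideanSpace ℝ (Fin d))}
    (hs : s ∈ T.faces)
    (hi : (interior (convexHull ℝ (s : Set (EuclideanSpace ℝ (Fin d))))).Nonempty) :
    s.card = d + 1 := by
  rw [interior_convexHull_nonempty_iff_affineSpan_eq_top] at hi
  have h1 := (T.indep hs).affineSpan_eq_top_iff_card_eq_finrank_add_one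
  rw [Subtype.range_coe_subtype] at h1
  simpa using h1.1 hi

/-- Local inverse estimate: the gradient on a simplex that contains a ball of radius `r` is
controlled by the values at the vertices. -/
theorem sq_norm_gradient_le {D r : ℝ} (hr : 0 < r)
    (hD : ∀ s ∈ T.faces, Metric.diam (convexHull ℝ (s : Set (EuclideanSpace ℝ (Fin d)))) ≤ D)
    {v : EuclideanSpace ℝ (Fin d) → ℝ} (hv : v ∈ T.P1)
    {s : Finset (EuclideanSpace ℝ (Fin d))} (hs : s ∈ T.faces) {c y : EuclideanSpace ℝ (Fin d)}
    (hc : Metric.closedBall c r ⊆ convexHull ℝ (s : Set (EuclideanSpace ℝ (Fin d))))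
    (hy : y ∈ interior (convexHull ℝ (s : Set (EuclideanSpace ℝ (Fin d))))) :
    r ^ 2 * ‖∇ v y‖ ^ 2 ≤ T.localSum D v y := by
  obtain ⟨a, ha⟩ := hv.2.2 s hs
  have hyc := interior_subset hy
  let A : EuclideanSpace ℝ (Fin d) →ᴬ[ℝ] ℝ := ⟨a, a.continuous_of_finiteDimensional⟩
  have hA : HasFDerivAt v A.contLinear y := by
    have h1 : HasFDerivAt A A.contLinear y := A.hasFDerivAt
    refine h1.congr_of_eventuallyEq ?_
    filter_upwards [mem_interior_iff_mem_nhds.1 hy] with z hz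
    exact ha hz
  set g := ∇ v y with hg
  have hgl : ∀ w, inner ℝ g w = a.linear w := fun w => by
    rw [hg, gradient, hA.fderiv, InnerProductSpace.toDual_symm_apply]
    rfl
  rcases eq_or_ne g 0 with h0 | h0
  · simpa [h0] using T.localSum_nonneg D v y
  have hgn : 0 < ‖g‖ := norm_pos_iff.2 h0
  -- A vector of length `r` along the gradient: `c ± w` stay in the simplex, and the mean of the
  -- squares of `v (c ± w)` is `(a c)² + r²‖g‖²`.
  set w := (r / ‖g‖) • g with hw
  have hwn : ‖w‖ = r := by
    rw [hw, norm_smul, Real.norm_of_nonneg (by positivity)]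
    field_simp
  have hm1 : c + w ∈ convexHull ℝ (s : Set (EuclideanSpace ℝ (Fin d))) :=
    hc (by simp [hwn])
  have hm2 : c - w ∈ convexHull ℝ (s : Set (EuclideanSpace ℝ (Fin d))) :=
    hc (by simp [hwn])
  have hlin : a.linear w = r * ‖g‖ := by
    rw [← hgl, hw, real_inner_smul_right, real_inner_self_eq_norm_sq]
    field_simp
  have e1 : v (c + w) = a c + r * ‖g‖ := by
    rw [ha hm1, add_comm c w, ← vadd_eq_add, a.map_vadd, hlin, vadd_eq_add, add_comm]
  have e2 : v (c - w) = a c - r * ‖g‖ := by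
    rw [ha hm2, sub_eq_neg_add, ← vadd_eq_add, a.map_vadd, map_neg, hlin, vadd_eq_add]
    ring
  have b1 := T.sq_le_localSum hD hv hs hyc hm1
  have b2 := T.sq_le_localSum hD hv hs hyc hm2
  rw [e1] at b1
  rw [e2] at b2
  nlinarith [sq_nonneg (a c)]

theorem stiffness_self_le {D r : ℝ} (hD0 : 0 ≤ D) (hr : 0 < r)
    (hD : ∀ s ∈ T.faces, Metric.diam (convexHull ℝ (s : Set (EuclideanSpace ℝ (Fin d)))) ≤ D)
    (hball : ∀ s ∈ T.faces, s.card = d + 1 →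
      ∃ c, Metric.closedBall c r ⊆ convexHull ℝ (s : Set (EuclideanSpace ℝ (Fin d))))
    (v : T.P1) :
    r ^ 2 * T.stiffness v v ≤
      D ^ d * volume.real (Metric.ball (0 : EuclideanSpace ℝ (Fin d)) 1) *
        ∑ x ∈ T.interiorVertices, v.1 x ^ 2 := by
  refine le_trans ?_ (T.integral_localSum_le hD0 v.1)
  rw [stiffness_apply, ← integral_const_mul]
  refine setIntegral_mono_ae_restrict
    ((T.integrableOn_inner_gradient v.2 v.2).const_mul _)
    (T.integrable_localSum D v.1).integrableOn ?_
  refine Filter.Eventually.filter_mono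
    (ae_mono (Measure.restrict_mono' T.ae_mem_interior le_rfl)) ?_
  have hm : MeasurableSet (⋃ s ∈ T.faces,
      interior (convexHull ℝ (s : Set (EuclideanSpace ℝ (Fin d))))) :=
    (isOpen_biUnion fun _ _ => isOpen_interior).measurableSet
  filter_upwards [ae_restrict_mem hm] with y hy
  obtain ⟨s, hs, hys⟩ := mem_iUnion₂.1 hy
  obtain ⟨c, hc⟩ := hball s hs (T.card_eq_of_interior_nonempty hs ⟨y, hys⟩)
  rw [real_inner_self_eq_norm_sq]
  exact T.sq_norm_gradient_le hr hD v.2 hs hc hys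

/-- The interiors of distinct simplices are disjoint. -/
theorem disjoint_interior {s t : Finset (EuclideanSpace ℝ (Fin d))} (hs : s ∈ T.faces)
    (ht : t ∈ T.faces) (hst : s ≠ t) :
    Disjoint (interior (convexHull ℝ (s : Set (EuclideanSpace ℝ (Fin d)))))
      (interior (convexHull ℝ (t : Set (EuclideanSpace ℝ (Fin d))))) := by
  classical
  rw [Set.disjoint_iff_inter_eq_empty, ← Set.not_nonempty_iff_eq_empty]
  intro hne
  have hsc := T.card_eq_of_interior_nonempty hs hne.left
  have htc := T.card_eq_of_interior_nonempty ht hne.right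
  rw [← interior_inter] at hne
  -- By conformity the overlap lies in the hull of the common face `s ∩ t`. An interior point forces
  -- that face to have `d + 1` vertices, hence to equal both `s` and `t`.
  have hne' := hne.mono (interior_mono (T.inter_subset_convexHull hs ht))
  rw [← Finset.coe_inter] at hne'
  have hne'' : (s ∩ t).Nonempty := by
    have := (hne'.mono interior_subset)
    rw [convexHull_nonempty_iff] at this
    exact_mod_cast this
  have hcard := T.card_eq_of_interior_nonempty
    (T.down_closed hs Finset.inter_subset_left hne'') hne'
  have h1 := Finset.eq_of_subset_of_card_le (Finset.inter_subset_left (s₁ := s) (s₂ := t))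
    (by omega)
  have h2 := Finset.eq_of_subset_of_card_le (Finset.inter_subset_right (s₁ := s) (s₂ := t))
    (by omega)
  exact hst (h1.symm.trans h2)

/-- Every interior vertex is a vertex of a `d`-dimensional simplex. -/
theorem exists_full_simplex (hΩ : IsOpen Ω) {x : EuclideanSpace ℝ (Fin d)}
    (hx : x ∈ T.interiorVertices) : ∃ s ∈ T.faces, s.card = d + 1 ∧ x ∈ s := by
  classical
  obtain ⟨hxv, hxΩ⟩ := T.mem_interiorVertices.1 hx
  set U := ⋃ s ∈ {s ∈ T.faces | s.card = d + 1},
    convexHull ℝ (s : Set (EuclideanSpace ℝ (Fin d))) with hU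
  have hclosed : IsClosed U :=
    (T.finite_faces.subset (fun s hs => hs.1)).isClosed_biUnion
      fun s _ => (s.finite_toSet.isCompact_convexHull ℝ).isClosed
  -- The part of `Ω` missed by the closed set `U` is open and null, hence empty.
  have hsub : Ω ⊆ U := by
    have hnull : volume (Ω \ U) = 0 := by
      refine measure_mono_null ?_ (ae_le_set.1 T.ae_mem_interior)
      refine sdiff_subset_sdiff_right (iUnion₂_subset fun s hs y hy => ?_)
      exact mem_biUnion (x := s) ⟨hs, T.card_eq_of_interior_nonempty hs ⟨y, hy⟩⟩
        (interior_subset hy)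
    have hopen : IsOpen (Ω \ U) := hΩ.sdiff hclosed
    exact sdiff_eq_empty.1 (hopen.eq_empty_of_measure_zero hnull)
  obtain ⟨s, ⟨hs, hsc⟩, hxs⟩ := mem_iUnion₂.1 (hsub hxΩ)
  refine ⟨s, hs, hsc, ?_⟩
  have h1 := T.inter_subset_convexHull hs hxv ⟨hxs, subset_convexHull ℝ _ (by simp)⟩
  by_contra hxn
  have h2 : ((s : Set (EuclideanSpace ℝ (Fin d))) ∩
      (({x} : Finset (EuclideanSpace ℝ (Fin d))) : Set (EuclideanSpace ℝ (Fin d)))) = ∅ := by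
    simpa using hxn
  rw [h2, convexHull_empty] at h1
  exact h1

/-- The values at the vertices of a `d`-dimensional simplex are controlled by the `L₂` norm on that
simplex. -/
theorem sum_sq_vertices_le {r : ℝ} (hr : 0 < r) {v : EuclideanSpace ℝ (Fin d) → ℝ}
    (hv : v ∈ T.P1) {s : Finset (EuclideanSpace ℝ (Fin d))} (hs : s ∈ T.faces)
    (hsc : s.card = d + 1) {c : EuclideanSpace ℝ (Fin d)}
    (hc : Metric.closedBall c r ⊆ convexHull ℝ (s : Set (EuclideanSpace ℝ (Fin d)))) :
    (r / 3) ^ d * volume.real (Metric.ball (0 : EuclideanSpace ℝ (Fin d)) 1) *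
        ∑ x ∈ s, v x ^ 2 ≤
      9 * (d + 1) * ∫ y in interior (convexHull ℝ (s : Set (EuclideanSpace ℝ (Fin d)))),
        v y * v y := by
  obtain ⟨a, ha⟩ := hv.2.2 s hs
  obtain ⟨x, hx, hmax⟩ := s.exists_max_image (fun x => |v x|) (Finset.card_pos.1 (by omega))
  have hxs := subset_convexHull ℝ (s : Set (EuclideanSpace ℝ (Fin d))) hx
  -- The homothety with centre `x` and ratio `1/3` carries the inscribed ball to a ball of radius
  -- `r/3` about `b`. There `v` is `2/3` of its value at the maximizing vertex `x` plus `1/3` of a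
  -- value no larger in modulus, so `|v| ≥ |v x|/3`.
  set b := AffineMap.lineMap x c (1 / 3 : ℝ) with hb
  have hpt : ∀ w ∈ Metric.ball b (r / 3),
      w ∈ convexHull ℝ (s : Set (EuclideanSpace ℝ (Fin d))) ∧ v x ^ 2 / 9 ≤ v w * v w := by
    intro w hw
    set z := x + (3 : ℝ) • (w - x) with hz
    have hwz : AffineMap.lineMap x z (1 / 3 : ℝ) = w := by
      rw [AffineMap.lineMap_apply_module', hz, add_sub_cancel_left, smul_smul]
      norm_num
    have hzc : z - c = (3 : ℝ) • (w - b) := by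
      rw [hz, hb, AffineMap.lineMap_apply_module']
      module
    have hzs : z ∈ convexHull ℝ (s : Set (EuclideanSpace ℝ (Fin d))) := by
      refine hc ?_
      rw [Metric.mem_ball, dist_eq_norm] at hw
      rw [Metric.mem_closedBall, dist_eq_norm, hzc, norm_smul]
      norm_num
      linarith
    have hws : w ∈ convexHull ℝ (s : Set (EuclideanSpace ℝ (Fin d))) := by
      rw [← hwz]
      exact (convex_convexHull ℝ _).lineMap_mem hxs hzs (by norm_num)
    refine ⟨hws, ?_⟩
    have hvw : v w = 2 / 3 * v x + 1 / 3 * v z := by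
      rw [ha hws, ha hxs, ha hzs, ← hwz, a.apply_lineMap, AffineMap.lineMap_apply_module]
      simp only [smul_eq_mul]
      ring
    obtain ⟨x', hx', hle⟩ := T.exists_vertex_abs_le hv hs hzs
    have hzx := abs_le.1 (hle.trans (hmax x' hx'))
    have h3 : |v x| / 3 ≤ |v w| := by
      rw [hvw]
      rcases abs_cases (v x) with h | h <;> rcases abs_cases (2 / 3 * v x + 1 / 3 * v z) with h' | h'
        <;> linarith
    calc v x ^ 2 / 9 = (|v x| / 3) ^ 2 := by rw [div_pow, sq_abs]; norm_num
      _ ≤ |v w| ^ 2 := by gcongr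
      _ = v w * v w := by rw [sq_abs, sq]
  have hsub : Metric.ball b (r / 3) ⊆
      interior (convexHull ℝ (s : Set (EuclideanSpace ℝ (Fin d)))) :=
    interior_maximal (fun w hw => (hpt w hw).1) Metric.isOpen_ball
  have hint : v x ^ 2 / 9 * volume.real (Metric.ball b (r / 3)) ≤
      ∫ y in interior (convexHull ℝ (s : Set (EuclideanSpace ℝ (Fin d)))), v y * v y := by
    refine le_trans ?_ (setIntegral_mono_set (T.integrable_mul hv hv).integrableOn
      (.of_forall fun y => mul_self_nonneg (v y)) hsub.eventuallyLE)
    rw [mul_comm, ← smul_eq_mul, ← setIntegral_const]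
    exact setIntegral_mono_on (integrableOn_const measure_ball_lt_top.ne)
      (T.integrable_mul hv hv).integrableOn measurableSet_ball fun w hw => (hpt w hw).2
  rw [measureReal_def, Measure.addHaar_ball_of_pos _ _ (by positivity : 0 < r / 3),
    finrank_euclideanSpace_fin, ENNReal.toReal_mul, ENNReal.toReal_ofReal (by positivity),
    ← measureReal_def] at hint
  have hsum : ∑ y ∈ s, v y ^ 2 ≤ (d + 1) * v x ^ 2 := by
    have := Finset.sum_le_card_nsmul s (fun y => v y ^ 2) (v x ^ 2)
      (fun y hy => sq_le_sq.2 (hmax y hy))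
    rw [hsc, nsmul_eq_mul] at this
    exact_mod_cast this
  have hω : 0 ≤ (r / 3) ^ d * volume.real (Metric.ball (0 : EuclideanSpace ℝ (Fin d)) 1) := by
    positivity
  calc _ ≤ (r / 3) ^ d * volume.real (Metric.ball (0 : EuclideanSpace ℝ (Fin d)) 1) *
        ((d + 1) * v x ^ 2) := by gcongr
    _ = 9 * (d + 1) * (v x ^ 2 / 9 * ((r / 3) ^ d *
        volume.real (Metric.ball (0 : EuclideanSpace ℝ (Fin d)) 1))) := by ring
    _ ≤ _ := by gcongr

/-- Every interior vertex belongs to a full-dimensional simplex, and the interiors of these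
simplices are disjoint, so the local bounds add up. -/
theorem sum_sq_le_mass {r : ℝ} (hr : 0 < r) (hΩ : IsOpen Ω)
    (hball : ∀ s ∈ T.faces, s.card = d + 1 →
      ∃ c, Metric.closedBall c r ⊆ convexHull ℝ (s : Set (EuclideanSpace ℝ (Fin d))))
    (v : T.P1) :
    (r / 3) ^ d * volume.real (Metric.ball (0 : EuclideanSpace ℝ (Fin d)) 1) *
        ∑ x ∈ T.interiorVertices, v.1 x ^ 2 ≤ 9 * (d + 1) * T.mass v v := by
  classical
  set S := T.finite_faces.toFinset.filter fun s => s.card = d + 1 with hS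
  have hSm : ∀ s, s ∈ S ↔ s ∈ T.faces ∧ s.card = d + 1 := fun s => by simp [hS]
  have h1 : ∑ x ∈ T.interiorVertices, v.1 x ^ 2 ≤ ∑ s ∈ S, ∑ x ∈ s, v.1 x ^ 2 := by
    have hcover : ∀ x ∈ T.interiorVertices, v.1 x ^ 2 ≤
        ∑ s ∈ S, if x ∈ s then v.1 x ^ 2 else 0 := by
      intro x hx
      obtain ⟨s, hs, hsc, hxs⟩ := T.exists_full_simplex hΩ hx
      have := Finset.single_le_sum (f := fun s => if x ∈ s then v.1 x ^ 2 else 0)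
        (fun s _ => by split_ifs <;> positivity) ((hSm s).2 ⟨hs, hsc⟩)
      simpa only [if_pos hxs] using this
    refine (Finset.sum_le_sum hcover).trans ?_
    rw [Finset.sum_comm]
    refine Finset.sum_le_sum fun s _ => ?_
    rw [← Finset.sum_filter]
    refine Finset.sum_le_sum_of_subset_of_nonneg (fun x hx => (Finset.mem_filter.1 hx).2)
      fun _ _ _ => sq_nonneg _
  have h2 : ∑ s ∈ S, ∫ y in interior (convexHull ℝ (s : Set (EuclideanSpace ℝ (Fin d)))),
      v.1 y * v.1 y ≤ T.mass v v := by
    rw [← integral_biUnion_finset S (fun _ _ => isOpen_interior.measurableSet)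
      (fun s hs t ht hst => T.disjoint_interior ((hSm s).1 hs).1 ((hSm t).1 ht).1 hst)
      (fun _ _ => (T.integrable_mul v.2 v.2).integrableOn), mass_apply,
      setIntegral_eq_integral_of_forall_compl_eq_zero (s := Ω)
        (fun x hx => by simp [v.2.2.1 x hx])]
    exact setIntegral_le_integral (T.integrable_mul v.2 v.2)
      (.of_forall fun x => mul_self_nonneg (v.1 x))
  have h3 : (r / 3) ^ d * volume.real (Metric.ball (0 : EuclideanSpace ℝ (Fin d)) 1) *
      ∑ s ∈ S, ∑ x ∈ s, v.1 x ^ 2 ≤ 9 * (d + 1) *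
      ∑ s ∈ S, ∫ y in interior (convexHull ℝ (s : Set (EuclideanSpace ℝ (Fin d)))),
        v.1 y * v.1 y := by
    rw [Finset.mul_sum, Finset.mul_sum]
    refine Finset.sum_le_sum fun s hs => ?_
    obtain ⟨hs, hsc⟩ := (hSm s).1 hs
    obtain ⟨c, hc⟩ := hball s hs hsc
    exact T.sum_sq_vertices_le hr v.2 hs hsc hc
  have hω : 0 ≤ (r / 3) ^ d * volume.real (Metric.ball (0 : EuclideanSpace ℝ (Fin d)) 1) := by
    positivity
  calc _ ≤ _ := mul_le_mul_of_nonneg_left h1 hω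
    _ ≤ _ := h3
    _ ≤ _ := by gcongr

end Triangulation

end KKTMultigrid

/-! ### Richardson iteration and Cauchy–Schwarz for abstract forms. -/

namespace KKTMultigrid

/-- Optimally damped Richardson iteration is a contraction in the energy norm. -/
theorem richardson_contraction_inner {E : Type*} [NormedAddCommGroup E] [InnerProductSpace ℝ E]
    [FiniteDimensional ℝ E] {A : E →ₗ[ℝ] E} (hA : A.IsSymmetric) {α Λ : ℝ} (hα : 0 < α)
    (hlo : ∀ u, α * inner ℝ u u ≤ inner ℝ (A u) u)
    (hup : ∀ u, inner ℝ (A u) u ≤ Λ * inner ℝ u u) {l : ℝ}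
    (hl : l = 2 / (sInf {μ : ℝ | Module.End.HasEigenvalue A μ} +
      sSup {μ : ℝ | Module.End.HasEigenvalue A μ})) (u : E) :
    inner ℝ (A (u - l • A u)) (u - l • A u) ≤
      ((Λ - α) / (Λ + α)) ^ 2 * inner ℝ (A u) u := by
  set Sp := {μ : ℝ | Module.End.HasEigenvalue A μ} with hSp
  have hbd : ∀ μ ∈ Sp, α ≤ μ ∧ μ ≤ Λ := by
    intro μ hμ
    obtain ⟨w, hw⟩ := Module.End.HasEigenvalue.exists_hasEigenvector hμ
    have hAw := hw.apply_eq_smul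
    have hpos : 0 < inner ℝ w w := real_inner_self_pos.2 hw.2
    have h1 := hlo w
    have h2 := hup w
    rw [hAw, real_inner_smul_left] at h1 h2
    exact ⟨le_of_mul_le_mul_right h1 hpos, le_of_mul_le_mul_right h2 hpos⟩
  have hbb : BddBelow Sp := ⟨α, fun μ hμ => (hbd μ hμ).1⟩
  have hba : BddAbove Sp := ⟨Λ, fun μ hμ => (hbd μ hμ).2⟩
  let b := hA.eigenvectorBasis rfl
  let e := hA.eigenvalues rfl
  have he : ∀ i, e i ∈ Sp := fun i => hA.hasEigenvalue_eigenvalues rfl i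
  have hrep : ∀ (w : E) i, inner ℝ (b i) (A w) = e i * inner ℝ (b i) w := fun w i => by
    rw [← hA (b i) w]
    have : A (b i) = e i • b i := hA.apply_eigenvectorBasis rfl i
    rw [this, real_inner_smul_left]
  have hform : ∀ w, inner ℝ (A w) w = ∑ i, e i * inner ℝ (b i) w ^ 2 := fun w => by
    rw [← b.sum_inner_mul_inner]
    refine Finset.sum_congr rfl fun i _ => ?_
    rw [real_inner_comm, hrep]
    ring
  rw [hform, hform, Finset.mul_sum]
  refine Finset.sum_le_sum fun i _ => ?_
  -- The index `i` supplies nonemptiness, so `sInf` and `sSup` are genuine bounds; on the zero space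
  -- the sum is empty.
  have hne : Sp.Nonempty := ⟨_, he i⟩
  have h1 : sInf Sp ≤ e i := csInf_le hbb (he i)
  have h2 : e i ≤ sSup Sp := le_csSup hba (he i)
  have h3 : α ≤ sInf Sp := le_csInf hne fun μ hμ => (hbd μ hμ).1
  have h4 : sSup Sp ≤ Λ := csSup_le hne fun μ hμ => (hbd μ hμ).2
  have hsum : 0 < sInf Sp + sSup Sp := by linarith
  have hΛ : 0 < Λ + α := by linarith
  have hq : |1 - l * e i| ≤ (Λ - α) / (Λ + α) := by
    have h5 : 1 - l * e i = (sInf Sp + sSup Sp - 2 * e i) / (sInf Sp + sSup Sp) := by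
      rw [hl]
      field_simp
    -- The left side increases with the condition number, which is at most `Λ/α`.
    have h6 : (sSup Sp - sInf Sp) / (sInf Sp + sSup Sp) ≤ (Λ - α) / (Λ + α) := by
      rw [div_le_div_iff₀ hsum hΛ]
      nlinarith
    refine le_trans ?_ h6
    rw [h5, abs_div, abs_of_pos hsum]
    gcongr
    rw [abs_le]
    constructor <;> linarith
  have hq2 : (1 - l * e i) ^ 2 ≤ ((Λ - α) / (Λ + α)) ^ 2 := by
    rw [← sq_abs]
    gcongr
  have hcoord : inner ℝ (b i) (u - l • A u) = (1 - l * e i) * inner ℝ (b i) u := by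
    rw [inner_sub_right, real_inner_smul_right, hrep]
    ring
  rw [hcoord, mul_pow, mul_left_comm]
  have : 0 ≤ e i := by linarith
  gcongr

/-- Cauchy–Schwarz for a bilinear form dominated by a pair of quadratic functions. -/
theorem sq_le_mul_of_two_mul_le {E : Type*} [AddCommGroup E] [Module ℝ E] {F : Type*}
    [AddCommGroup F] [Module ℝ F]
    (B : E →ₗ[ℝ] F →ₗ[ℝ] ℝ) {p : E → ℝ} {q : F → ℝ} (hq : ∀ (t : ℝ) w, q (t • w) = t ^ 2 * q w)
    (h : ∀ u w, 2 * B u w ≤ p u + q w) (u : E) (w : F) : B u w ^ 2 ≤ p u * q w := by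
  -- Scaling `w` by `t` gives the nonnegative quadratic `q w t² - 2 B u w t + p u`.
  have h1 := discrim_le_zero (a := q w) (b := -2 * B u w) (c := p u) fun t => by
    have := h u (t • w)
    rw [hq, map_smul, smul_eq_mul] at this
    nlinarith
  unfold discrim at h1
  nlinarith

theorem bilinForm_sq_le {E : Type*} [AddCommGroup E] [Module ℝ E] {B : LinearMap.BilinForm ℝ E}
    (hs : ∀ u w, B u w = B w u) (h0 : ∀ u, 0 ≤ B u u) (u w : E) :
    B u w ^ 2 ≤ B u u * B w w := by
  refine sq_le_mul_of_two_mul_le B (p := fun u => B u u) (q := fun u => B u u)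
    (fun t w => by simp only [map_smul, LinearMap.smul_apply, smul_eq_mul]; ring) (fun u w => ?_) u w
  have := h0 (u - w)
  simp only [map_sub, LinearMap.sub_apply, hs w u] at this
  linarith

/-- Optimally damped Richardson iteration is a contraction in the energy norm; version for a
positive definite bilinear form. -/
theorem richardson_contraction {E : Type*} [AddCommGroup E] [Module ℝ E] [FiniteDimensional ℝ E]
    {ip : LinearMap.BilinForm ℝ E} (hs : ∀ u w, ip u w = ip w u) (h0 : ∀ u, 0 ≤ ip u u)
    (hd : ∀ u, ip u u = 0 → u = 0) {A : Module.End ℝ E} (hA : ∀ u w, ip (A u) w = ip u (A w))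
    {α Λ : ℝ} (hα : 0 < α) (hlo : ∀ u, α * ip u u ≤ ip (A u) u)
    (hup : ∀ u, ip (A u) u ≤ Λ * ip u u) {l : ℝ}
    (hl : l = 2 / (sInf {μ : ℝ | Module.End.HasEigenvalue A μ} +
      sSup {μ : ℝ | Module.End.HasEigenvalue A μ})) (u : E) :
    ip (A (u - l • A u)) (u - l • A u) ≤ ((Λ - α) / (Λ + α)) ^ 2 * ip (A u) u := by
  let core : InnerProductSpace.Core ℝ E :=
    { inner := fun u w => ip u w
      conj_inner_symm := fun u w => hs w u
      re_inner_nonneg := h0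
      add_left := fun u v w => by simp
      smul_left := fun u v r => by simp
      definite := hd }
  let _ : NormedAddCommGroup E := core.toNormedAddCommGroup
  let _ : InnerProductSpace ℝ E := InnerProductSpace.ofCore core.toCore
  exact richardson_contraction_inner (E := E) (A := A) hA hα hlo hup hl u

end KKTMultigrid

/-! ### The saddle form in the weighted norm. -/

namespace KKTMultigrid

namespace Triangulation

variable {d : ℕ} {Ω : Set (EuclideanSpace ℝ (Fin d))} (T : Triangulation Ω)

/-- The squared weighted norm on pairs of finite element functions. -/
noncomputable def pairNormSq (β : ℝ) (u : T.P1 × T.P1) : ℝ :=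
  T.normSqH1β β u.1 + T.normSqH1β β u.2

/-- The test function `(p - y, -y - p)` for the inf-sup condition at `(p, y)`. -/
def twist (u : T.P1 × T.P1) : T.P1 × T.P1 := (u.1 - u.2, -u.2 - u.1)

theorem nodal_symm (h : ℝ) (v w : T.P1) : T.nodal h v w = T.nodal h w v := by
  simp only [nodal_apply, mul_comm]

theorem nodalPair_symm (h : ℝ) (u w : T.P1 × T.P1) :
    T.nodalPair h u w = T.nodalPair h w u := by
  rw [nodalPair_apply, nodalPair_apply, T.nodal_symm h u.1, T.nodal_symm h u.2]

theorem nodalPair_self_nonneg {h : ℝ} (hh : 0 < h) (u : T.P1 × T.P1) :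
    0 ≤ T.nodalPair h u u :=
  add_nonneg (T.nodal_self_nonneg hh _) (T.nodal_self_nonneg hh _)

theorem eq_zero_of_nodalPair_self {h : ℝ} (hh : 0 < h) {u : T.P1 × T.P1}
    (hu : T.nodalPair h u u = 0) : u = 0 := by
  rw [nodalPair_apply] at hu
  have a1 := T.nodal_self_nonneg hh u.1
  have a2 := T.nodal_self_nonneg hh u.2
  exact Prod.ext (T.eq_zero_of_nodal_self hh (by linarith))
    (T.eq_zero_of_nodal_self hh (by linarith))

theorem pairNormSq_nonneg (β : ℝ) (u : T.P1 × T.P1) : 0 ≤ T.pairNormSq β u :=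
  add_nonneg
    (add_nonneg (T.mass_self_nonneg _)
      (mul_nonneg (Real.sqrt_nonneg β) (T.stiffness_self_nonneg _)))
    (add_nonneg (T.mass_self_nonneg _)
      (mul_nonneg (Real.sqrt_nonneg β) (T.stiffness_self_nonneg _)))

theorem pairNormSq_smul (β t : ℝ) (u : T.P1 × T.P1) :
    T.pairNormSq β (t • u) = t ^ 2 * T.pairNormSq β u := by
  simp only [pairNormSq, normSqH1β, Prod.smul_fst, Prod.smul_snd, map_smul, LinearMap.smul_apply,
    smul_eq_mul]
  ring

theorem pairNormSq_twist (β : ℝ) (u : T.P1 × T.P1) :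
    T.pairNormSq β (T.twist u) = 2 * T.pairNormSq β u := by
  simp only [pairNormSq, normSqH1β, twist, map_sub, map_neg, LinearMap.sub_apply,
    LinearMap.neg_apply, T.mass_symm u.2 u.1, T.stiffness_symm u.2 u.1]
  ring

theorem nodalPair_twist (h : ℝ) (u : T.P1 × T.P1) :
    T.nodalPair h (T.twist u) (T.twist u) = 2 * T.nodalPair h u u := by
  simp only [nodalPair_apply, twist, map_sub, map_neg, LinearMap.sub_apply, LinearMap.neg_apply,
    T.nodal_symm h u.2 u.1]
  ring

theorem saddle_symm (β : ℝ) (u w : T.P1 × T.P1) : T.saddle β u w = T.saddle β w u := by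
  rw [saddle_apply, saddle_apply, T.stiffness_symm u.1, T.stiffness_symm u.2, T.mass_symm u.1,
    T.mass_symm u.2]
  ring

/-- The inf-sup condition: by symmetry all cross terms cancel, uniformly in `β`. -/
theorem saddle_twist (β : ℝ) (u : T.P1 × T.P1) :
    T.saddle β u (T.twist u) = T.pairNormSq β u := by
  simp only [saddle_apply, pairNormSq, normSqH1β, twist, map_sub, map_neg, T.mass_symm u.2 u.1,
    T.stiffness_symm u.2 u.1]
  ring

theorem saddle_sq_le (β : ℝ) (u w : T.P1 × T.P1) :
    T.saddle β u w ^ 2 ≤ T.pairNormSq β u * T.pairNormSq β w := by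
  refine sq_le_mul_of_two_mul_le _ (fun t w => T.pairNormSq_smul β t w) (fun u w => ?_) u w
  -- The four squares below add up to `pairNormSq u + pairNormSq w - 2 𝓑(u, w)`.
  have h1 := T.mass_self_nonneg (u.2 + w.1)
  have h2 := T.mass_self_nonneg (u.1 + w.2)
  have h3 := mul_nonneg (Real.sqrt_nonneg β) (T.stiffness_self_nonneg (u.1 - w.1))
  have h4 := mul_nonneg (Real.sqrt_nonneg β) (T.stiffness_self_nonneg (u.2 + w.2))
  simp only [map_add, map_sub, LinearMap.add_apply, LinearMap.sub_apply, T.mass_symm w.1 u.2,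
    T.mass_symm w.2 u.1, T.stiffness_symm w.1 u.1, T.stiffness_symm w.2 u.2] at h1 h2 h3 h4
  simp only [saddle_apply, pairNormSq, normSqH1β]
  nlinarith

end Triangulation

/-! ### Norm equivalence and spectral bounds, uniform in the level and in `β`. -/

namespace MeshHierarchy

variable {d : ℕ} {Ω : Set (EuclideanSpace ℝ (Fin d))} (M : MeshHierarchy Ω)

theorem exists_normSqH1β_equiv (hΩ : IsOpen Ω) :
    ∃ a b : ℝ, 0 < a ∧ 0 < b ∧ ∀ (β : ℝ) (k : ℕ), Real.sqrt β * (M.h k ^ 2)⁻¹ < 1 →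
      ∀ v : M.V k, a * (M.T k).nodal (M.h k) v v ≤ (M.T k).normSqH1β β v ∧
        (M.T k).normSqH1β β v ≤ b * (M.T k).nodal (M.h k) v v := by
  set ω := volume.real (Metric.ball (0 : EuclideanSpace ℝ (Fin d)) 1) with hω
  have hωpos : 0 < ω := ENNReal.toReal_pos
    (Metric.measure_ball_pos volume 0 one_pos).ne' measure_ball_lt_top.ne
  have hσ := M.σ_pos
  refine ⟨(1 / (3 * M.σ)) ^ d * ω / (9 * (d + 1)), M.σ ^ d * ω * (1 + M.σ ^ 2), by positivity,
    by positivity, fun β k hβ v => ?_⟩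
  have hh := M.h_pos k
  have hr : 0 < M.h k / M.σ := by positivity
  have h1 := (M.T k).mass_self_le (by positivity) (M.diam_le k) v
  have h2 := (M.T k).stiffness_self_le (by positivity) hr (M.diam_le k) (M.ball_subset k) v
  have h3 := (M.T k).sum_sq_le_mass hr hΩ (M.ball_subset k) v
  have hn : (M.T k).nodal (M.h k) v v =
      M.h k ^ d * ∑ x ∈ (M.T k).interiorVertices, v.1 x ^ 2 := by
    simp only [Triangulation.nodal_apply, sq]
  have hst := (M.T k).stiffness_self_nonneg v
  have hsβ := Real.sqrt_nonneg β
  have hd1 : (0 : ℝ) < 9 * (d + 1) := by positivity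
  unfold Triangulation.normSqH1β
  constructor
  · have h4 : (1 / (3 * M.σ)) ^ d * ω / (9 * (d + 1)) * (M.T k).nodal (M.h k) v v ≤
        (M.T k).mass v v := by
      rw [div_mul_eq_mul_div, div_le_iff₀ hd1, hn, mul_comm _ (9 * ((d : ℝ) + 1))]
      refine le_trans (le_of_eq ?_) h3
      have : M.h k / M.σ / 3 = 1 / (3 * M.σ) * M.h k := by field_simp
      rw [this, mul_pow]
      ring
    have := mul_nonneg hsβ hst
    linarith
  · rw [mul_pow] at h1 h2
    have h5 : (M.T k).mass v v ≤ M.σ ^ d * ω * (M.T k).nodal (M.h k) v v := by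
      rw [hn]
      exact h1.trans (le_of_eq (by ring))
    have h6 : Real.sqrt β * (M.T k).stiffness v v ≤
        M.σ ^ d * ω * M.σ ^ 2 * (M.T k).nodal (M.h k) v v := by
      -- The only use of `β^{1/2} h_k⁻² < 1`: the factor `β^{1/2}` compensates the `h_k⁻²` of the
      -- inverse estimate.
      have h7 : Real.sqrt β ≤ M.h k ^ 2 := by
        rw [← div_eq_mul_inv, div_lt_one (by positivity)] at hβ
        exact hβ.le
      calc Real.sqrt β * (M.T k).stiffness v v ≤ M.h k ^ 2 * (M.T k).stiffness v v := by gcongr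
        _ = M.σ ^ 2 * ((M.h k / M.σ) ^ 2 * (M.T k).stiffness v v) := by field_simp
        _ ≤ M.σ ^ 2 * _ := mul_le_mul_of_nonneg_left h2 (by positivity)
        _ = _ := by rw [hn]; ring
    linarith

variable {M} {β a b c₁ c₂ : ℝ} {k : ℕ} {L : Module.End ℝ (M.V k)}

theorem pairNormSq_equiv
    (hab : ∀ v : M.V k, a * (M.T k).nodal (M.h k) v v ≤ (M.T k).normSqH1β β v ∧
        (M.T k).normSqH1β β v ≤ b * (M.T k).nodal (M.h k) v v) (u : M.W k) :
    a * M.ip k u u ≤ (M.T k).pairNormSq β u ∧ (M.T k).pairNormSq β u ≤ b * M.ip k u u := by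
  rw [Triangulation.nodalPair_apply, mul_add, mul_add]
  exact ⟨add_le_add (hab u.1).1 (hab u.2).1, add_le_add (hab u.1).2 (hab u.2).2⟩

theorem ip_symm (k : ℕ) (u w : M.W k) : M.ip k u w = M.ip k w u :=
  (M.T k).nodalPair_symm _ u w

theorem ip_self_nonneg (k : ℕ) (u : M.W k) : 0 ≤ M.ip k u u :=
  (M.T k).nodalPair_self_nonneg (M.h_pos k) u

theorem ip_sq_le (k : ℕ) (u w : M.W k) : M.ip k u w ^ 2 ≤ M.ip k u u * M.ip k w w :=
  bilinForm_sq_le (ip_symm k) (ip_self_nonneg k) u w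

/-- Serves to absorb one factor `x` after Cauchy–Schwarz. -/
theorem le_mul_of_sq_le_mul {x y z c : ℝ} (hx : 0 ≤ x) (hy : 0 ≤ y) (hc : 0 ≤ c)
    (h : x ^ 2 ≤ y * z) (hz : z ≤ c * x) : x ≤ c * y := by
  rcases hx.eq_or_lt with rfl | hx'
  · positivity
  · refine le_of_mul_le_mul_right ?_ hx'
    nlinarith [mul_le_mul_of_nonneg_left hz hy]

theorem ip_opB_self_le (hb : 0 < b)
    (hN : ∀ u : M.W k, (M.T k).pairNormSq β u ≤ b * M.ip k u u) (u : M.W k) :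
    M.ip k (M.opB β k u) (M.opB β k u) ≤ b ^ 2 * M.ip k u u := by
  have h1 := (M.T k).saddle_sq_le β u (M.opB β k u)
  rw [← M.ip_opB] at h1
  have h0 := ip_self_nonneg k u
  refine (le_mul_of_sq_le_mul (ip_self_nonneg k _) ((M.T k).pairNormSq_nonneg β u) hb.le h1 (hN _)).trans ?_
  nlinarith [hN u]

/-- Cauchy–Schwarz for `[𝔅_k u, twist u]_k`, which equals the squared weighted norm of `u`; the
factor 2 comes from the length of the twist. -/
theorem ip_self_le_opB (ha : 0 < a)
    (hN : ∀ u : M.W k, a * M.ip k u u ≤ (M.T k).pairNormSq β u) (u : M.W k) :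
    a ^ 2 * M.ip k u u ≤ 2 * M.ip k (M.opB β k u) (M.opB β k u) := by
  have h1 := ip_sq_le k (M.opB β k u) ((M.T k).twist u)
  rw [M.ip_opB, Triangulation.saddle_twist, Triangulation.nodalPair_twist] at h1
  have h2 := le_mul_of_sq_le_mul (c := 2 / a) ((M.T k).pairNormSq_nonneg β u)
    (ip_self_nonneg k _) (by positivity) h1 (by
      have := hN u
      rw [div_mul_eq_mul_div, le_div_iff₀ ha]
      linarith)
  rw [div_mul_eq_mul_div, le_div_iff₀ ha] at h2
  nlinarith [hN u]

theorem ip_opC_symm (hL : M.IsAdmissible β c₁ c₂ k L) (u w : M.W k) :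
    M.ip k (opC L u) w = M.ip k u (opC L w) :=
  congrArg₂ (· + ·) (hL.1 u.1 w.1) (hL.1 u.2 w.2)

theorem ip_opC_self (hL : M.IsAdmissible β c₁ c₂ k L) (u : M.W k) :
    c₁ * (M.T k).pairNormSq β u ≤ M.ip k (opC L u) u ∧
      M.ip k (opC L u) u ≤ c₂ * (M.T k).pairNormSq β u := by
  rw [Triangulation.pairNormSq, mul_add, mul_add]
  exact ⟨add_le_add (hL.2 u.1).1 (hL.2 u.2).1, add_le_add (hL.2 u.1).2 (hL.2 u.2).2⟩

theorem opC_inverse_apply (hc₁ : 0 < c₁) (hL : M.IsAdmissible β c₁ c₂ k L) (f : M.W k) :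
    opC L (Ring.inverse (opC L) f) = f := by
  rw [← Module.End.mul_apply, Ring.mul_inverse_cancel _ (isUnit_opC hc₁ hL), Module.End.one_apply]

theorem opA_apply (u : M.W k) :
    opA β L u = M.opB β k (Ring.inverse (opC L) (M.opB β k u)) := rfl

theorem postSmooth_apply (u : M.W k) : postSmooth β L u = u - damping β L • opA β L u := rfl

theorem preSmooth_apply (u : M.W k) :
    preSmooth β L u =
      u - damping β L • Ring.inverse (opC L) (M.opB β k (M.opB β k u)) := by
  rw [preSmooth, sq]
  rfl

/-- Exhibits the energy form as the form of `ℭ_k` pulled back along `ℭ_k⁻¹ 𝔅_k`, whence its symmetry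
and positivity. -/
theorem ip_opA (hc₁ : 0 < c₁) (hL : M.IsAdmissible β c₁ c₂ k L) (u w : M.W k) :
    M.ip k (opA β L u) w = M.ip k (opC L (Ring.inverse (opC L) (M.opB β k u)))
      (Ring.inverse (opC L) (M.opB β k w)) := by
  rw [opA_apply, M.ip_opB, Triangulation.saddle_symm, ← M.ip_opB, ip_opC_symm hL, opC_inverse_apply hc₁ hL, ip_symm]

theorem ip_opA_symm (hc₁ : 0 < c₁) (hL : M.IsAdmissible β c₁ c₂ k L) (u w : M.W k) :
    M.ip k (opA β L u) w = M.ip k u (opA β L w) := by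
  rw [ip_symm k u, ip_opA hc₁ hL, ip_opA hc₁ hL w, ip_opC_symm hL, ip_symm]

/-- Spectral bounds for `𝔅_k ℭ_k⁻¹ 𝔅_k`. -/
theorem ip_opA_self_bounds (ha : 0 < a) (hb : 0 < b) (hc₁ : 0 < c₁) (hc₂ : 0 < c₂)
    (hN : ∀ u : M.W k,
      a * M.ip k u u ≤ (M.T k).pairNormSq β u ∧ (M.T k).pairNormSq β u ≤ b * M.ip k u u)
    (hL : M.IsAdmissible β c₁ c₂ k L) (u : M.W k) :
    a ^ 2 / (2 * c₂ * b) * M.ip k u u ≤ M.ip k (opA β L u) u ∧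
      M.ip k (opA β L u) u ≤ b ^ 2 / (c₁ * a) * M.ip k u u := by
  rw [ip_opA hc₁ hL]
  set g := Ring.inverse (opC L) (M.opB β k u) with hg
  have hCg : opC L g = M.opB β k u := opC_inverse_apply hc₁ hL _
  have hB1 := ip_opB_self_le hb (fun u => (hN u).2) u
  have hB2 := ip_self_le_opB ha (fun u => (hN u).1) u
  rw [← hCg] at hB1 hB2
  have hC0 : ∀ w, 0 ≤ M.ip k (opC L w) w := fun w =>
    (mul_nonneg hc₁.le ((M.T k).pairNormSq_nonneg β w)).trans (ip_opC_self hL w).1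
  constructor
  -- Cauchy–Schwarz in the `ℭ_k` form between `g` and `ℭ_k g` yields `[ℭ_k g, ℭ_k g] ≤ c₂ b [ℭ_k g,
  -- g]`, and `ℭ_k g = 𝔅_k u`.
  · have h1 := bilinForm_sq_le (B := (M.ip k).comp (opC L) LinearMap.id)
      (fun u w => (ip_opC_symm hL u w).trans (ip_symm k _ _)) hC0 g (opC L g)
    simp only [LinearMap.BilinForm.comp_apply, LinearMap.id_apply] at h1
    have h2 := le_mul_of_sq_le_mul (c := c₂ * b) (ip_self_nonneg k _) (hC0 _) (by positivity) h1 (by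
      have := mul_le_mul_of_nonneg_left (hN (opC L g)).2 hc₂.le
      linarith [(ip_opC_self hL (opC L g)).2])
    rw [div_mul_eq_mul_div, div_le_iff₀ (by positivity)]
    linarith
  · have h1 := ip_sq_le k (opC L g) g
    have h2 := le_mul_of_sq_le_mul (c := 1 / (c₁ * a)) (hC0 g) (ip_self_nonneg k _)
      (by positivity) h1 (by
        have := mul_le_mul_of_nonneg_left (hN g).1 hc₁.le
        rw [div_mul_eq_mul_div, le_div_iff₀ (by positivity)]
        linarith [(ip_opC_self hL g).1])
    rw [div_mul_eq_mul_div, le_div_iff₀ (by positivity)] at h2 ⊢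
    linarith

/-! ### Smoothing, coarse-grid correction and the two-grid operator. -/

theorem postSmooth_contraction {α Λ : ℝ} (hα : 0 < α) (hc₁ : 0 < c₁)
    (hA : ∀ u : M.W k, α * M.ip k u u ≤ M.ip k (opA β L u) u ∧
      M.ip k (opA β L u) u ≤ Λ * M.ip k u u)
    (hL : M.IsAdmissible β c₁ c₂ k L) (m : ℕ) (u : M.W k) :
    M.ip k (opA β L ((postSmooth β L ^ m) u)) ((postSmooth β L ^ m) u) ≤
      (((Λ - α) / (Λ + α)) ^ m) ^ 2 * M.ip k (opA β L u) u := by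
  induction m with
  | zero => simp
  | succ m ih =>
    rw [pow_succ', Module.End.mul_apply, postSmooth_apply]
    refine (richardson_contraction (ip_symm k) (ip_self_nonneg k)
      (fun u hu => (M.T k).eq_zero_of_nodalPair_self (M.h_pos k) hu) (ip_opA_symm hc₁ hL) hα
      (fun u => (hA u).1) (fun u => (hA u).2) (l := damping β L) rfl _).trans ?_
    calc _ ≤ ((Λ - α) / (Λ + α)) ^ 2 *
          ((((Λ - α) / (Λ + α)) ^ m) ^ 2 * M.ip k (opA β L u) u) := by gcongr
      _ = _ := by ring

/-- Pre- and post-smoothing are intertwined by `𝔅_k`. -/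
theorem opB_preSmooth_pow (m : ℕ) (u : M.W k) :
    M.opB β k ((preSmooth β L ^ m) u) = (postSmooth β L ^ m) (M.opB β k u) := by
  induction m with
  | zero => rfl
  | succ m ih =>
    rw [pow_succ', pow_succ', Module.End.mul_apply, Module.End.mul_apply, ← ih, preSmooth_apply,
      postSmooth_apply, opA_apply, map_sub, map_smul]

/-- Stability of the Ritz projection in the weighted norm. -/
theorem pairNormSq_ritz_le {j : ℕ} (hjk : j ≤ k) (u : M.W k) :
    (M.T j).pairNormSq β (M.ritz β hjk u) ≤ 2 * (M.T k).pairNormSq β u := by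
  set q := M.ritz β hjk u with hq
  have h1 : (M.T j).pairNormSq β q =
      (M.T k).saddle β u (M.prolong hjk ((M.T j).twist q)) := by
    rw [← M.saddle_ritz, Triangulation.saddle_twist]
  have h2 := (M.T k).saddle_sq_le β u (M.prolong hjk ((M.T j).twist q))
  -- Prolongation does not change the functions and all integrals are over the same `Ω`, so the
  -- level `j` identity applies definitionally.
  have h3 : (M.T k).pairNormSq β (M.prolong hjk ((M.T j).twist q)) =
      2 * (M.T j).pairNormSq β q := (M.T j).pairNormSq_twist β q
  rw [← h1, h3] at h2
  exact le_mul_of_sq_le_mul ((M.T j).pairNormSq_nonneg β q) ((M.T k).pairNormSq_nonneg β u)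
    zero_le_two h2 le_rfl

theorem ip_coarse_correction_le {j : ℕ} (hjk : j ≤ k) (ha : 0 < a)
    (hN : ∀ u : M.W k,
      a * M.ip k u u ≤ (M.T k).pairNormSq β u ∧ (M.T k).pairNormSq β u ≤ b * M.ip k u u)
    (u : M.W k) :
    M.ip k (u - M.prolong hjk (M.ritz β hjk u)) (u - M.prolong hjk (M.ritz β hjk u)) ≤
      (2 + 4 * b / a) * M.ip k u u := by
  set z := M.prolong hjk (M.ritz β hjk u) with hz
  have h1 : a * M.ip k z z ≤ 2 * (b * M.ip k u u) := by
    calc a * M.ip k z z ≤ (M.T k).pairNormSq β z := (hN z).1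
      _ = (M.T j).pairNormSq β (M.ritz β hjk u) := rfl
      _ ≤ 2 * (M.T k).pairNormSq β u := pairNormSq_ritz_le hjk u
      _ ≤ _ := by linarith [(hN u).2]
  have h2 : M.ip k z z ≤ 2 * b / a * M.ip k u u := by
    rw [div_mul_eq_mul_div, le_div_iff₀ ha]
    linarith
  -- Gives `[u - z, u - z] ≤ 2 [u, u] + 2 [z, z]`.
  have h3 := ip_self_nonneg k (u + z)
  simp only [map_add, map_sub, LinearMap.add_apply, LinearMap.sub_apply, ip_symm k z u] at h3 ⊢
  have h4 : 4 * b / a = 2 * (2 * b / a) := by ring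
  rw [h4]
  linarith

theorem opNorm1_le {Q : Module.End ℝ (M.W k)} {r : ℝ} (hr : 0 ≤ r)
    (h : ∀ u, M.ip k (opA β L (Q u)) (Q u) ≤ r ^ 2 * M.ip k (opA β L u) u) :
    opNorm1 β L Q ≤ ENNReal.ofReal r := by
  refine iInf₂_le r.toNNReal fun u => ?_
  rw [Real.coe_toNNReal r hr]
  refine (Real.sqrt_le_sqrt (h u)).trans (le_of_eq ?_)
  rw [Real.sqrt_mul (sq_nonneg r), Real.sqrt_sq hr, norm1]

/-- After post-smoothing the energy norm is exchanged for the nodal norm to apply the coarse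
correction. Then `𝔅_k` is inserted at a bounded cost, because the pre-smoother contracts `𝔅_k v`
rather than `v`. -/
theorem twoGrid_bound {α Λ : ℝ} (hα : 0 < α) (hΛ : 0 < Λ) (ha : 0 < a) (hb : 0 < b) (hc₁ : 0 < c₁)
    (hN : ∀ u : M.W k,
      a * M.ip k u u ≤ (M.T k).pairNormSq β u ∧ (M.T k).pairNormSq β u ≤ b * M.ip k u u)
    (hA : ∀ u : M.W k, α * M.ip k u u ≤ M.ip k (opA β L u) u ∧
      M.ip k (opA β L u) u ≤ Λ * M.ip k u u)
    (hL : M.IsAdmissible β c₁ c₂ k L) (m₁ m₂ : ℕ) (u : M.W k) :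
    M.ip k (opA β L (twoGrid β L m₁ m₂ u)) (twoGrid β L m₁ m₂ u) ≤
      Λ * (2 + 4 * b / a) * (2 / a ^ 2) * (1 / α) * (Λ * b ^ 2 / α) *
        (((Λ - α) / (Λ + α)) ^ (m₁ + m₂)) ^ 2 * M.ip k (opA β L u) u := by
  set γ := (Λ - α) / (Λ + α) with hγ
  set v := (preSmooth β L ^ m₁) u with hv
  set z := v - M.prolong (Nat.sub_le k 1) (M.ritz β (Nat.sub_le k 1) v) with hz
  have hQ : twoGrid β L m₁ m₂ u = (postSmooth β L ^ m₂) z := rfl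
  have h1 := postSmooth_contraction hα hc₁ hA hL m₂ z
  have h2 := (hA z).2
  have h3 : M.ip k z z ≤ _ := ip_coarse_correction_le (Nat.sub_le k 1) ha hN v
  have h4 : M.ip k v v ≤ 2 / a ^ 2 * M.ip k (M.opB β k v) (M.opB β k v) := by
    rw [div_mul_eq_mul_div, le_div_iff₀ (by positivity)]
    linarith [ip_self_le_opB ha (fun u => (hN u).1) v]
  have hBv : M.opB β k v = (postSmooth β L ^ m₁) (M.opB β k u) := opB_preSmooth_pow m₁ u
  have h5 : M.ip k (M.opB β k v) (M.opB β k v) ≤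
      1 / α * M.ip k (opA β L (M.opB β k v)) (M.opB β k v) := by
    rw [div_mul_eq_mul_div, le_div_iff₀ hα]
    linarith [(hA (M.opB β k v)).1]
  have h6 := postSmooth_contraction hα hc₁ hA hL m₁ (M.opB β k u)
  rw [← hBv] at h6
  have h7 : M.ip k (opA β L (M.opB β k u)) (M.opB β k u) ≤
      Λ * b ^ 2 / α * M.ip k (opA β L u) u := by
    have e1 := (hA (M.opB β k u)).2
    have e2 := mul_le_mul_of_nonneg_left (ip_opB_self_le hb (fun u => (hN u).2) u) hΛ.le
    have e3 := mul_le_mul_of_nonneg_left (hA u).1 (show 0 ≤ Λ * b ^ 2 / α by positivity)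
    have e4 : Λ * b ^ 2 / α * (α * M.ip k u u) = Λ * (b ^ 2 * M.ip k u u) := by
      field_simp
    linarith
  rw [hQ]
  calc _ ≤ _ := h1
    _ ≤ (γ ^ m₂) ^ 2 * (Λ * ((2 + 4 * b / a) * (2 / a ^ 2 * (1 / α * ((γ ^ m₁) ^ 2 *
        (Λ * b ^ 2 / α * M.ip k (opA β L u) u)))))) := by
      refine mul_le_mul_of_nonneg_left (h2.trans ?_) (sq_nonneg _)
      refine mul_le_mul_of_nonneg_left (h3.trans ?_) hΛ.le
      refine mul_le_mul_of_nonneg_left (h4.trans ?_) (by positivity)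
      refine mul_le_mul_of_nonneg_left (h5.trans ?_) (by positivity)
      refine mul_le_mul_of_nonneg_left (h6.trans ?_) (by positivity)
      exact mul_le_mul_of_nonneg_left h7 (sq_nonneg _)
    _ = _ := by rw [pow_add]; ring

end MeshHierarchy

end KKTMultigrid

/-! ### The main theorem. -/

open KKTMultigrid MeshHierarchy in
theorem mainTheorem6 {d : ℕ} (hd : d = 2 ∨ d = 3) (Ω : Set (EuclideanSpace ℝ (Fin d)))
    (hΩ : KKTMultigrid.IsConvexPolytopalDomain Ω) (M : KKTMultigrid.MeshHierarchy Ω)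
    (c₁ c₂ : ℝ) (hc₁ : 0 < c₁) (hc₂ : 0 < c₂) :
    ∃ γ Csharp : ℝ, 0 < γ ∧ γ < 1 ∧ 0 < Csharp ∧
      ∀ (β : ℝ) (k : ℕ) (L : Module.End ℝ (M.V k)), 0 < β → 1 ≤ k →
        Real.sqrt β * (M.h k ^ 2)⁻¹ < 1 → M.IsAdmissible β c₁ c₂ k L →
          KKTMultigrid.MeshHierarchy.opNorm1 β L
              (KKTMultigrid.MeshHierarchy.postSmooth β L) ≤ ENNReal.ofReal γ ∧
          ∀ m₁ m₂ : ℕ,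
            KKTMultigrid.MeshHierarchy.opNorm1 β L
                (KKTMultigrid.MeshHierarchy.twoGrid β L m₁ m₂) ≤
              ENNReal.ofReal (Csharp * γ ^ (m₁ + m₂)) := by
  have hopen : IsOpen Ω := by
    obtain ⟨-, F, rfl⟩ := hΩ
    exact isOpen_interior
  obtain ⟨a, b, ha, hb, hab⟩ := M.exists_normSqH1β_equiv hopen
  set α := a ^ 2 / (2 * c₂ * b) with hα
  -- Adding `α` to the upper spectral bound makes `α < Λ` strict, so that `γ` is positive.
  set Λ := b ^ 2 / (c₁ * a) + α with hΛ
  have hα0 : 0 < α := by positivity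
  have hαΛ : α < Λ := lt_add_of_pos_left _ (by positivity)
  have hΛ0 : 0 < Λ := hα0.trans hαΛ
  have hγ : 0 < (Λ - α) / (Λ + α) := div_pos (by linarith) (by linarith)
  have hC : 0 < Λ * (2 + 4 * b / a) * (2 / a ^ 2) * (1 / α) * (Λ * b ^ 2 / α) := by positivity
  refine ⟨(Λ - α) / (Λ + α),
    -- `twoGrid_bound` controls squared norms, hence the root.
    Real.sqrt (Λ * (2 + 4 * b / a) * (2 / a ^ 2) * (1 / α) * (Λ * b ^ 2 / α)), hγ,
    (div_lt_one (by linarith)).2 (by linarith), Real.sqrt_pos.2 hC, ?_⟩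
  intro β k L _ _ hβ hL
  have hN := pairNormSq_equiv (hab β k hβ)
  have hA : ∀ u : M.W k, α * M.ip k u u ≤ M.ip k (opA β L u) u ∧
      M.ip k (opA β L u) u ≤ Λ * M.ip k u u := fun u => by
    have h1 := ip_opA_self_bounds ha hb hc₁ hc₂ hN hL u
    refine ⟨h1.1, h1.2.trans ?_⟩
    exact mul_le_mul_of_nonneg_right (le_add_of_nonneg_right hα0.le) (ip_self_nonneg k u)
  refine ⟨opNorm1_le hγ.le fun u => ?_, fun m₁ m₂ => opNorm1_le (by positivity) fun u => ?_⟩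
  · simpa using postSmooth_contraction hα0 hc₁ hA hL 1 u
  · rw [mul_pow, Real.sq_sqrt hC.le]
    exact twoGrid_bound hα0 hΛ0 ha hb hc₁ hN hA hL m₁ m₂ u
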